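/- For an increasing sequence $\vec n=(n_k)$ of positive integers let $Q_{\vec n}=\prod_k M_{n_k}(\mathbb C)\big/\sum_k M_{n_k}(\mathbb C)$, where $\prod_k M_{n_k}(\mathbb C)$ is the C*-algebra of norm-bounded sequences of matrices and $\sum_k M_{n_k}(\mathbb C)$ is the ideal of sequences with $\|a_k\|\to 0$. A countable group is called MF if it embeds in the unitary group of $Q_{\vec n}$ for some such $\vec n$. A separable C*-algebra $A$ is quasidiagonal if it has a faithful representation $\pi$ on a separable Hilbert space $H$ for which there is an increasing sequence of compact self-adjoint projections $P_k$ with $P_k\to 1_H$ strongly and $\|P_kT-TP_k\|\to 0$ for every $T\in\pi(A)$. **Theorem.** Let $\Gamma$ be a countable discrete residually finite group and let $N$ be a central subgroup of $\Gamma$. Then: 1. $\Gamma/N$ is MF. 2. The embedding can be obtained from induced representations: there are a strictly increasing sequence $\vec n=(n_k)$ of positive integers and unitary representations $\sigma_k\colon\Gamma\to U(n_k)$ such that $xN\mapsto[(\sigma_k(x))_k]$ is a well-defined injective homomorphism $\Gamma/N\to U(Q_{\vec n})$, and such that each $\sigma_k$ is, up to unitary equivalence, of the form $\bigl(\mathrm{Ind}_{Z_k}^{\Gamma/L_k}\gamma_k\bigr)\circ\pi_k$,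 where $L_k$ is a finite-index normal subgroup of $\Gamma$, $\pi_k\colon\Gamma\to\Gamma/L_k$ is the quotient map, $Z_k$ is a central subgroup of $\Gamma/L_k$ and $\gamma_k$ is a finite-dimensional unitary representation of $Z_k$. 3. If in addition $\Gamma$ is amenable, then the full group C*-algebra $C^*(\Gamma/N)$ is quasidiagonal. -/

import Mathlib

open Filter Topology
open scoped ENNReal Pointwise Matrix Matrix.Norms.L2Operator

noncomputable section

/-! ### Amenability -/

/-- A (discrete) group is amenable if it carries a left-invariant finitely additive probability
measure defined on all of its subsets. -/
def IsAmenableGroup (G : Type*) [Group G] : Prop :=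
  ∃ m : Set G → ℝ≥0∞, m Set.univ = 1 ∧
    (∀ s t : Set G, Disjoint s t → m (s ∪ t) = m s + m t) ∧
    ∀ (g : G) (s : Set G), m (g • s) = m s

/-! ### The C*-algebra `∏ M_{n_k}(ℂ) / ∑ M_{n_k}(ℂ)` and MF groups -/

/-- `∏_k M_{n_k}(ℂ)`: bounded sequences of matrices, for the operator norm on matrices. -/
abbrev MatrixProd (n : ℕ → ℕ+) : Type :=
  lp (fun k => Matrix (Fin (n k)) (Fin (n k)) ℂ) ∞

/-- `∑_k M_{n_k}(ℂ)`: the two-sided ideal of sequences of matrices whose norms tend to `0`. -/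
def matrixSum (n : ℕ → ℕ+) : Ideal (MatrixProd n) where
  carrier := {a | Tendsto (fun k => ‖a k‖) atTop (𝓝 0)}
  zero_mem' := by simp
  add_mem' {a b} ha hb := by
    refine squeeze_zero (fun k => norm_nonneg _) (fun k => ?_) (by simpa using ha.add hb)
    simpa using norm_add_le (a k) (b k)
  smul_mem' c a ha := by
    refine squeeze_zero (fun k => norm_nonneg _) (fun k => ?_) (by simpa using ha.const_mul ‖c‖)
    have h1 : ‖(c * a) k‖ ≤ ‖c k‖ * ‖a k‖ := by
      rw [lp.infty_coeFn_mul]; exact norm_mul_le _ _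
    exact h1.trans (mul_le_mul_of_nonneg_right (lp.norm_apply_le_norm (by simp) c k)
      (norm_nonneg _))

lemma mem_matrixSum {n : ℕ → ℕ+} {a : MatrixProd n} :
    a ∈ matrixSum n ↔ Tendsto (fun k => ‖a k‖) atTop (𝓝 0) := Iff.rfl

instance (n : ℕ → ℕ+) : (matrixSum n).IsTwoSided where
  mul_mem_of_left {a} b ha := by
    rw [mem_matrixSum] at ha ⊢
    refine squeeze_zero (fun k => norm_nonneg _) (fun k => ?_) (by simpa using ha.mul_const ‖b‖)
    have h1 : ‖(a * b) k‖ ≤ ‖a k‖ * ‖b k‖ := by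
      rw [lp.infty_coeFn_mul]; exact norm_mul_le _ _
    exact h1.trans (mul_le_mul_of_nonneg_left (lp.norm_apply_le_norm (by simp) b k)
      (norm_nonneg _))

lemma star_mem_matrixSum {n : ℕ → ℕ+} {a : MatrixProd n} (ha : a ∈ matrixSum n) :
    star a ∈ matrixSum n := by
  rw [mem_matrixSum] at ha ⊢
  simpa using ha

/-- The quotient `Q_n = ∏_k M_{n_k}(ℂ) / ∑_k M_{n_k}(ℂ)`. -/
def MatrixCorona (n : ℕ → ℕ+) : Type := MatrixProd n ⧸ matrixSum n

instance (n : ℕ → ℕ+) : Ring (MatrixCorona n) := Ideal.Quotient.ring (matrixSum n)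

/-- The quotient map `∏_k M_{n_k}(ℂ) → Q_n`. -/
def MatrixCorona.mk (n : ℕ → ℕ+) : MatrixProd n →+* MatrixCorona n :=
  Ideal.Quotient.mk (matrixSum n)

lemma MatrixCorona.mk_surjective (n : ℕ → ℕ+) : Function.Surjective (MatrixCorona.mk n) :=
  Ideal.Quotient.mk_surjective

lemma MatrixCorona.mk_eq_mk_iff {n : ℕ → ℕ+} {a b : MatrixProd n} :
    MatrixCorona.mk n a = MatrixCorona.mk n b ↔ Tendsto (fun k => ‖a k - b k‖) atTop (𝓝 0) :=
  (Ideal.Quotient.eq (I := matrixSum n)).trans (by simp [mem_matrixSum])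

/-- The involution of `Q_n`, induced by the entrywise adjoint of sequences. -/
instance (n : ℕ → ℕ+) : StarRing (MatrixCorona n) where
  star := Quotient.map' star fun a b h => by
    rw [Submodule.quotientRel_def] at h ⊢
    simpa using star_mem_matrixSum h
  star_involutive x := by
    obtain ⟨a, rfl⟩ := MatrixCorona.mk_surjective n x
    exact congrArg (MatrixCorona.mk n) (star_star a)
  star_mul x y := by
    obtain ⟨a, rfl⟩ := MatrixCorona.mk_surjective n x
    obtain ⟨b, rfl⟩ := MatrixCorona.mk_surjective n y
    exact congrArg (MatrixCorona.mk n) (star_mul a b)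
  star_add x y := by
    obtain ⟨a, rfl⟩ := MatrixCorona.mk_surjective n x
    obtain ⟨b, rfl⟩ := MatrixCorona.mk_surjective n y
    exact congrArg (MatrixCorona.mk n) (star_add a b)

lemma MatrixCorona.star_mk {n : ℕ → ℕ+} (a : MatrixProd n) :
    star (MatrixCorona.mk n a) = MatrixCorona.mk n (star a) := rfl

/-- A group is MF if it embeds in the unitary group of `Q_n` for some increasing sequence `n` of
positive integers. -/
def IsMFGroup (G : Type*) [Group G] : Prop :=
  ∃ n : ℕ → ℕ+, StrictMono n ∧
    ∃ Φ : G →* unitary (MatrixCorona n), Function.Injective Φ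

/-! ### Induced representations -/

/-- The space `{ξ : F → ℂ^d | ξ(xh) = γ(h⁻¹) ξ(x) for x ∈ F, h ∈ H}` of the representation of `F`
induced by a unitary representation `γ` of the subgroup `H`. -/
def inducedSpace {F : Type*} [Group F] {H : Subgroup F} {d : ℕ}
    (γ : H →* Matrix.unitaryGroup (Fin d) ℂ) : Submodule ℂ (F → Fin d → ℂ) where
  carrier := {ξ | ∀ (x : F) (h : H),
    ξ (x * h) = (γ h⁻¹ : Matrix (Fin d) (Fin d) ℂ) *ᵥ ξ x}
  zero_mem' := by simp
  add_mem' {ξ η} hξ hη x h := by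
    simp only [Pi.add_apply, Matrix.mulVec_add]; rw [hξ x h, hη x h]
  smul_mem' c ξ hξ x h := by
    simp only [Pi.smul_apply, Matrix.mulVec_smul]; rw [hξ x h]

/-- `τ : F → U(m)` is (a matrix form of) the induced unitary representation `Ind_H^F γ`: there is a
unitary `T` from `ℂ^m` onto `inducedSpace γ`, equipped with the inner product
`⟨ξ, η⟩ = ∑_{xH ∈ F/H} ⟨ξ(x), η(x)⟩`, that carries `τ(g)` to the translation
`(g · ξ)(x) = ξ(g⁻¹ x)`. -/
def IsInducedRep {F : Type*} [Group F] [Finite F] {H : Subgroup F} {d m : ℕ}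
    (γ : H →* Matrix.unitaryGroup (Fin d) ℂ) (τ : F →* Matrix.unitaryGroup (Fin m) ℂ) : Prop :=
  ∃ T : (Fin m → ℂ) →ₗ[ℂ] (F → Fin d → ℂ),
    LinearMap.range T = inducedSpace γ ∧
    (∀ v w : Fin m → ℂ,
      star v ⬝ᵥ w = ∑ᶠ c : F ⧸ H, star (T v c.out) ⬝ᵥ T w c.out) ∧
    ∀ (g : F) (v : Fin m → ℂ) (x : F),
      T ((τ g : Matrix (Fin m) (Fin m) ℂ) *ᵥ v) x = T v (g⁻¹ * x)

/-- `σ : Γ → U(m)` factors as the quotient map onto a finite quotient `Γ / L` followed by a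
representation induced from a finite-dimensional unitary representation of a central subgroup of
`Γ / L`. -/
def IsInducedFromCentralOfFiniteQuotient {Γ : Type*} [Group Γ] {m : ℕ}
    (σ : Γ →* Matrix.unitaryGroup (Fin m) ℂ) : Prop :=
  ∃ (L : FiniteIndexNormalSubgroup Γ) (H : Subgroup (Γ ⧸ L.toSubgroup)) (d : ℕ)
    (γ : H →* Matrix.unitaryGroup (Fin d) ℂ)
    (τ : Γ ⧸ L.toSubgroup →* Matrix.unitaryGroup (Fin m) ℂ),
    H ≤ Subgroup.center (Γ ⧸ L.toSubgroup) ∧ IsInducedRep γ τ ∧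
    σ = τ.comp (QuotientGroup.mk' L.toSubgroup)

/-! ### Quasidiagonality -/

/-- A set of operators on a Hilbert space is quasidiagonal if there is an increasing sequence of
compact (equivalently finite-rank) self-adjoint projections that tends strongly to the identity
and asymptotically commutes in norm with every operator in the set. -/
def IsQuasidiagonalSet {H : Type*} [NormedAddCommGroup H] [InnerProductSpace ℂ H]
    [CompleteSpace H] (Ω : Set (H →L[ℂ] H)) : Prop :=
  ∃ P : ℕ → (H →L[ℂ] H),
    (∀ k, IsStarProjection (P k)) ∧
    (∀ k, IsCompactOperator (P k)) ∧
    (∀ k l, k ≤ l → P k * P l = P k) ∧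
    (∀ x : H, Tendsto (fun k => P k x) atTop (𝓝 x)) ∧
    ∀ T ∈ Ω, Tendsto (fun k => ‖P k * T - T * P k‖) atTop (𝓝 0)

/-- A unital C*-algebra is quasidiagonal if it is separable and has a faithful representation on a
separable Hilbert space whose image is a quasidiagonal set of operators. -/
def IsQuasidiagonal (A : Type*) [CStarAlgebra A] : Prop :=
  TopologicalSpace.SeparableSpace A ∧
  ∃ (H : Type) (_ : NormedAddCommGroup H) (_ : InnerProductSpace ℂ H) (_ : CompleteSpace H)
    (_ : TopologicalSpace.SeparableSpace H) (π : A →⋆ₐ[ℂ] (H →L[ℂ] H)),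
    Function.Injective π ∧ IsQuasidiagonalSet (Set.range π)

/-! ### The full group C*-algebra -/

universe u

/-- A unitary representation of the discrete group `G : Type u` on a nonzero Hilbert space in
`Type u`. (Every cyclic representation of `G` is equivalent to one of these.) -/
structure UnitaryRep (G : Type u) [Group G] : Type (u + 1) where
  /-- the Hilbert space -/
  space : Type u
  [normed : NormedAddCommGroup space]
  [inner : InnerProductSpace ℂ space]
  [complete : CompleteSpace space]
  [nontriv : Nontrivial space]
  /-- the representation -/
  rep : G →* unitary (space →L[ℂ] space)

attribute [instance] UnitaryRep.normed UnitaryRep.inner UnitaryRep.complete UnitaryRep.nontriv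

/-- The C*-algebra of bounded families `(T_π)_π` of operators, `T_π` acting on the space of the
unitary representation `π`, with the supremum norm. -/
abbrev UnitaryRepProd (G : Type u) [Group G] : Type (u + 1) :=
  lp (fun π : UnitaryRep G => π.space →L[ℂ] π.space) ∞

instance (G : Type u) [Group G] : CStarAlgebra (UnitaryRepProd G) where

/-- The universal unitary representation `g ↦ (π(g))_π`. -/
def universalRep (G : Type u) [Group G] (g : G) : UnitaryRepProd G :=
  ⟨fun π => (π.rep g : π.space →L[ℂ] π.space), memℓp_infty ⟨1, by
    rintro _ ⟨π, rfl⟩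
    exact (CStarRing.norm_coe_unitary (π.rep g)).le⟩⟩

/-- The full group C*-algebra `C*(G)` as a C*-subalgebra of `UnitaryRepProd G`: the closure of the
*-algebra generated by the universal representation, that is, the completion of `ℂ[G]` in the norm
`‖f‖ = sup_π ‖π(f)‖`. -/
def groupCStarSubalgebra (G : Type u) [Group G] : StarSubalgebra ℂ (UnitaryRepProd G) :=
  (StarAlgebra.adjoin ℂ (Set.range (universalRep G))).topologicalClosure

/-- The full group C*-algebra `C*(G)` of a discrete group. -/
abbrev GroupCStarAlgebra (G : Type u) [Group G] : Type (u + 1) := groupCStarSubalgebra G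

instance (G : Type u) [Group G] : IsClosed (groupCStarSubalgebra G : Set (UnitaryRepProd G)) :=
  StarSubalgebra.isClosed_topologicalClosure _

end

/-!
Write `G = Γ/N`. The point is that `G` need not be residually finite, but `N`, being central and
hence abelian, is amenable, and this makes up for the defect.

*Approximation.* Given a finite set `E ⊆ Γ`, take a finitely supported unit vector `a` in `ℓ²(N)`
that is almost invariant under `E ∩ N`, and a finite quotient `F = Γ/L` that is injective on all
elements that matter. Let `Z` be the image of `N` in `F`, a central subgroup. The squared modulus of
the Fourier transform of `a` is a probability measure on the dual of `Z` (`charWeight`). Its Fourier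
coefficients are autocorrelations of `a`, so they are close to `1` on `E ∩ N` and vanish on elements
of `E \ N` whose image lies in `Z`. The first property says that most characters are almost trivial
on `E ∩ N`, and the others may be replaced by the trivial character (`exists_replace_characters`).
Inducing the direct sum of these characters from `Z` to `F` gives a representation in which `E ∩ N`
acts almost trivially in norm, because central elements act by the characters themselves, while
the weight provides a unit vector that `E \ N` moves to an almost orthogonal one, because elements
outside `Z` permute the cosets without fixed points (`exists_almost_trivial_on_central`). Along an
exhaustion of `Γ` these representations give the embedding into the corona
(`exists_embedding_of_central`).

*Quasidiagonality.* Let `Γ` be amenable. Then `G` is amenable, and by Namioka's argument it has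
almost invariant vectors in `ℓ²(G)` (`IsAmenableGroup.hasAlmostInvariantVectors`). Let `λ` be the
regular representation of `G` on `ℓ²(G, K)` with an infinite-dimensional multiplicity space `K`. For
an almost invariant vector `a` and unitary operators `u(x)`, the operator
`v ↦ ∑ₓ a(x) δₓ ⊗ u(x) v` (`spread`) is used twice.
* With `u(x) = π(x)⁻¹` for a representation `π` of `G`, it shows that `λ` is faithful on the full
  group C*-algebra (`HasAlmostInvariantVectors.norm_sum_smul_le`).
* With `u(x) = σ(x')⁻¹`, where `σ` is one of the finite-dimensional representations of `Γ` from the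
  first step and `x'` is a lift of `x`, it is an isometry that almost intertwines `σ` and `λ`. The
  projection onto its range has finite rank and almost commutes with `λ`. To make such projections
  converge strongly to `1`, they are moved by a unitary operator in the commutant of `λ`: the almost
  vanishing matrix coefficients of `σ` provide vectors close to the range whose translates are
  orthonormal, and these vectors can be reflected to `δ₁ ⊗ e_j`
  (`exists_almost_invariant_projection`).

Finally, an asymptotically commuting sequence of finite-rank projections that tends strongly to `1`
can be perturbed to an increasing one (`isQuasidiagonalSet_of_tendsto`).
-/

/-! ### Translations on `ℓ^p` spaces of functions on a group -/

section Translation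

variable {G : Type*} [Group G] {E : Type*} [NormedAddCommGroup E]

lemma memℓp_comp_equiv {α β : Type*} {p : ℝ≥0∞} [hp : Fact (1 ≤ p)] {f : β → E} (e : α ≃ β)
    (hf : Memℓp f p) : Memℓp (fun x => f (e x)) p := by
  rcases eq_or_ne p ∞ with rfl | h
  · obtain ⟨C, hC⟩ := memℓp_infty_iff.1 hf
    exact memℓp_infty ⟨C, by rintro _ ⟨x, rfl⟩; exact hC ⟨e x, rfl⟩⟩
  · have h0 : 0 < p.toReal := ENNReal.toReal_pos (by have := hp.out; positivity) h
    rw [memℓp_gen_iff h0] at hf ⊢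
    exact (e.summable_iff (f := fun x => ‖f x‖ ^ p.toReal)).2 hf

lemma lp_norm_comp_equiv {α β : Type*} {p : ℝ≥0∞} [hp : Fact (1 ≤ p)] (e : α ≃ β)
    (f : lp (fun _ : β => E) p) :
    ‖(⟨fun x => f (e x), memℓp_comp_equiv e f.2⟩ : lp (fun _ : α => E) p)‖ = ‖f‖ := by
  rcases eq_or_ne p ∞ with rfl | h
  · rw [lp.norm_eq_ciSup, lp.norm_eq_ciSup]
    exact e.surjective.iSup_comp (fun x => ‖f x‖)
  · have h0 : 0 < p.toReal := ENNReal.toReal_pos (by have := hp.out; positivity) h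
    rw [lp.norm_eq_tsum_rpow h0, lp.norm_eq_tsum_rpow h0]
    congr 1
    exact e.tsum_eq (fun x => ‖f x‖ ^ p.toReal)

/-- The left translation action of a group on `ℓ^p(G, E)`: `(g · f)(x) = f(g⁻¹ x)`. -/
noncomputable def lpTranslate (𝕜 : Type*) [NormedField 𝕜] [NormedSpace 𝕜 E] (p : ℝ≥0∞)
    [Fact (1 ≤ p)] : G →* (lp (fun _ : G => E) p ≃ₗᵢ[𝕜] lp (fun _ : G => E) p) where
  toFun g :=
    { toFun := fun f => ⟨fun x => f (g⁻¹ * x), memℓp_comp_equiv (Equiv.mulLeft g⁻¹) f.2⟩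
      invFun := fun f => ⟨fun x => f (g * x), memℓp_comp_equiv (Equiv.mulLeft g) f.2⟩
      left_inv := fun f => by ext x; simp
      right_inv := fun f => by ext x; simp
      map_add' := fun f f' => rfl
      map_smul' := fun c f => by ext x; simp
      norm_map' := fun f => lp_norm_comp_equiv (Equiv.mulLeft g⁻¹) f }
  map_one' := by ext f x; simp
  map_mul' g h := by
    ext f x
    change f ((g * h)⁻¹ * x) = f (h⁻¹ * (g⁻¹ * x))
    rw [mul_inv_rev, mul_assoc]

@[simp]
lemma lpTranslate_apply (𝕜 : Type*) [NormedField 𝕜] [NormedSpace 𝕜 E] (p : ℝ≥0∞)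
    [Fact (1 ≤ p)] (g : G) (f : lp (fun _ : G => E) p) (x : G) :
    lpTranslate 𝕜 p g f x = f (g⁻¹ * x) := rfl

end Translation

/-! ### Almost invariant vectors -/

section AlmostInvariant

/-- The left regular representation of `G` on `ℓ²(G)` has almost invariant unit vectors, which
moreover are real and finitely supported. -/
def HasAlmostInvariantVectors (G : Type*) [Group G] : Prop :=
  ∀ (S : Finset G) (ε : ℝ), 0 < ε → ∃ a : G → ℝ, a.support.Finite ∧ ∑' x, a x ^ 2 = 1 ∧
    ∀ s ∈ S, ∑' x, (a (s⁻¹ * x) - a x) ^ 2 ≤ ε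

/-- The finitely supported probability densities on `G`, as a subset of `ℓ¹(G)`. -/
def finiteDensities (G : Type*) : Set (lp (fun _ : G => ℝ) 1) :=
  {f | (Function.support f).Finite ∧ (∀ x, 0 ≤ f x) ∧ ∑' x, f x = 1}

lemma convex_finiteDensities {G : Type*} : Convex ℝ (finiteDensities G) := by
  rintro f ⟨hf1, hf2, hf3⟩ g ⟨hg1, hg2, hg3⟩ s t hs ht hst
  refine ⟨(hf1.union hg1).subset fun x hx => ?_, fun x => ?_, ?_⟩
  · by_contra h
    simp only [Set.mem_union, Function.mem_support, not_or, not_not] at h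
    exact hx (show s * f x + t * g x = 0 by simp [h.1, h.2])
  · have := hf2 x
    have := hg2 x
    simp only [lp.coeFn_add, lp.coeFn_smul, Pi.add_apply, Pi.smul_apply, smul_eq_mul]
    positivity
  · simp only [lp.coeFn_add, lp.coeFn_smul, Pi.add_apply, Pi.smul_apply, smul_eq_mul]
    rw [Summable.tsum_add, tsum_mul_left, tsum_mul_left, hf3, hg3]
    · simpa using hst
    · exact (summable_of_hasFiniteSupport hf1).mul_left _
    · exact (summable_of_hasFiniteSupport hg1).mul_left _

lemma single_mem_finiteDensities {G : Type*} [DecidableEq G] (g : G) :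
    lp.single 1 g (1 : ℝ) ∈ finiteDensities G := by
  refine ⟨(Set.finite_singleton g).subset fun x hx => ?_, fun x => ?_, ?_⟩
  · by_contra h
    exact hx (by simp [lp.single_apply, show x ≠ g from h])
  · rw [lp.single_apply, Pi.single_apply]
    split_ifs <;> norm_num
  · simp [lp.single_apply, Pi.single_apply]

lemma norm_eq_one_of_mem_finiteDensities {G : Type*} {f : lp (fun _ : G => ℝ) 1}
    (hf : f ∈ finiteDensities G) : ‖f‖ = 1 := by
  rw [lp.norm_eq_tsum_rpow (by simp)]
  simp only [ENNReal.toReal_one, Real.rpow_one, div_one]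
  rw [← hf.2.2]
  exact tsum_congr fun x => Real.norm_of_nonneg (hf.2.1 x)

variable {G : Type*} [Group G]

lemma lpTranslate_mem_finiteDensities (g : G) {f : lp (fun _ : G => ℝ) 1}
    (hf : f ∈ finiteDensities G) : lpTranslate ℝ 1 g f ∈ finiteDensities G := by
  obtain ⟨hf1, hf2, hf3⟩ := hf
  refine ⟨?_, fun x => hf2 _, ?_⟩
  · refine (hf1.image (fun x => g * x)).subset fun x hx => ⟨g⁻¹ * x, ?_, by simp⟩
    simpa using hx
  · rw [← hf3]
    exact (Equiv.mulLeft g⁻¹).tsum_eq (fun x => f x)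

/-- Almost invariant densities in `ℓ¹` give almost invariant vectors in `ℓ²`, by taking square
roots. -/
lemma HasAlmostInvariantVectors.of_finiteDensities
    (h : ∀ (S : Finset G) (ε : ℝ), 0 < ε →
      ∃ f ∈ finiteDensities G, ∀ s ∈ S, ‖lpTranslate ℝ 1 s f - f‖ < ε) :
    HasAlmostInvariantVectors G := by
  intro S ε hε
  obtain ⟨f, hf, hS⟩ := h S ε hε
  refine ⟨fun x => √(f x), hf.1.subset fun x hx => ?_, ?_, fun s hs => ?_⟩
  · intro h0
    simp [h0] at hx
  · rw [← hf.2.2]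
    exact tsum_congr fun x => Real.sq_sqrt (hf.2.1 x)
  · refine le_trans ?_ (hS s hs).le
    rw [lp.norm_eq_tsum_rpow (by simp)]
    simp only [ENNReal.toReal_one, Real.rpow_one, div_one]
    have hsum : Summable fun x => ‖(lpTranslate ℝ 1 s f - f) x‖ := by
      simpa using (lp.memℓp (lpTranslate ℝ 1 s f - f)).summable (by simp)
    have hle : ∀ x, (√(f (s⁻¹ * x)) - √(f x)) ^ 2 ≤ ‖(lpTranslate ℝ 1 s f - f) x‖ := by
      intro x
      have h1 := hf.2.1 (s⁻¹ * x)
      have h2 := hf.2.1 x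
      have h3 : (lpTranslate ℝ 1 s f - f) x
          = (√(f (s⁻¹ * x)) - √(f x)) * (√(f (s⁻¹ * x)) + √(f x)) := by
        simp only [lp.coeFn_sub, Pi.sub_apply, lpTranslate_apply]
        nlinarith [Real.sq_sqrt h1, Real.sq_sqrt h2]
      rw [h3, norm_mul, ← sq_abs, sq, Real.norm_eq_abs]
      refine mul_le_mul_of_nonneg_left ?_ (abs_nonneg _)
      rw [Real.norm_of_nonneg (by positivity)]
      have := Real.sqrt_nonneg (f (s⁻¹ * x))
      have := Real.sqrt_nonneg (f x)
      exact abs_le.2 ⟨by linarith, by linarith⟩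
    exact (Summable.of_nonneg_of_le (fun x => sq_nonneg _) hle hsum).tsum_le_tsum hle hsum

/-- Averaging over long powers of one element after another makes a density almost invariant. -/
lemma HasAlmostInvariantVectors.of_commute (hG : ∀ x y : G, x * y = y * x) :
    HasAlmostInvariantVectors G := by
  classical
  refine .of_finiteDensities fun S ε hε => ?_
  induction S using Finset.induction_on with
  | empty => exact ⟨_, single_mem_finiteDensities 1, by simp⟩
  | insert s S _ ih =>
    obtain ⟨f, hf, hS⟩ := ih
    obtain ⟨J, hJ⟩ := exists_nat_gt (2 / ε)
    have hJ0 : (0 : ℝ) < J := lt_trans (by positivity) hJ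
    set f' : lp (fun _ : G => ℝ) 1 :=
      ∑ j ∈ Finset.range J, (J : ℝ)⁻¹ • lpTranslate ℝ 1 (s ^ j) f with hf'
    have key : ∀ t : G, lpTranslate ℝ 1 t f' - f' = (J : ℝ)⁻¹ •
        ∑ j ∈ Finset.range J,
          (lpTranslate ℝ 1 (t * s ^ j) f - lpTranslate ℝ 1 (s ^ j) f) := by
      intro t
      simp [hf', map_sum, Finset.smul_sum, smul_sub, Finset.sum_sub_distrib]
    refine ⟨f', ?_, fun t ht => ?_⟩
    · refine convex_finiteDensities.sum_mem (fun _ _ => by positivity) ?_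
        fun j _ => lpTranslate_mem_finiteDensities _ hf
      simp [hJ0.ne']
    · rw [key, norm_smul, norm_inv, Real.norm_of_nonneg hJ0.le, inv_mul_lt_iff₀ hJ0]
      rcases Finset.mem_insert.1 ht with rfl | ht
      · have h1 : ∀ j, t * t ^ j = t ^ (j + 1) := fun j => (pow_succ' t j).symm
        simp only [h1]
        rw [Finset.sum_range_sub (fun j => lpTranslate ℝ 1 (t ^ j) f)]
        refine (norm_sub_le _ _).trans_lt ?_
        simp only [LinearIsometryEquiv.norm_map, norm_eq_one_of_mem_finiteDensities hf]
        rw [div_lt_iff₀ hε] at hJ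
        linarith
      · have hne : (Finset.range J).Nonempty := by
          rw [Finset.nonempty_range_iff]
          rintro rfl
          simp at hJ0
        refine (norm_sum_le _ _).trans_lt ?_
        have h2 : ∀ j ∈ Finset.range J,
            ‖lpTranslate ℝ 1 (t * s ^ j) f - lpTranslate ℝ 1 (s ^ j) f‖ < ε := by
          intro j _
          rw [hG t, map_mul, LinearIsometryEquiv.coe_mul, Function.comp_apply, ← map_sub,
            LinearIsometryEquiv.norm_map]
          exact hS t ht
        simpa using Finset.sum_lt_sum_of_nonempty hne h2

end AlmostInvariant

/-! ### Amenable groups have almost invariant vectors -/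

section Amenable

/-- A finitely additive measure is computed on preimages of a map to a finite type by summing over
fibres. -/
lemma measure_preimage_eq_sum_fibers {X Ω : Type*} {m : Set X → ℝ≥0∞} (h0 : m ∅ = 0)
    (hadd : ∀ s t : Set X, Disjoint s t → m (s ∪ t) = m s + m t) (T : X → Ω) (s : Finset Ω) :
    m (T ⁻¹' s) = ∑ ω ∈ s, m (T ⁻¹' {ω}) := by
  classical
  induction s using Finset.induction_on with
  | empty => simpa using h0
  | insert a s ha ih =>
    rw [Finset.sum_insert ha, ← ih, ← hadd]
    · congr 1
      ext x
      simp
    · rw [Set.disjoint_left]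
      rintro x hx hx'
      simp only [Set.mem_preimage, Set.mem_singleton_iff] at hx
      simp only [Set.mem_preimage, hx] at hx'
      exact ha hx'

/-- If a point always lies in more of the sets `B i` than of the sets `A i`, then the total mass
of the `B i` exceeds that of the `A i` by at least `1`. -/
lemma sum_measure_add_one_le {X I : Type*} [Fintype I] {m : Set X → ℝ≥0∞}
    (huniv : m Set.univ = 1)
    (hadd : ∀ s t : Set X, Disjoint s t → m (s ∪ t) = m s + m t) (A B : I → Set X)
    (hAB : ∀ x, {i | x ∈ A i}.ncard + 1 ≤ {i | x ∈ B i}.ncard) :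
    ∑ i, m (A i) + 1 ≤ ∑ i, m (B i) := by
  classical
  have h0 : m ∅ = 0 := by
    have h1 := hadd ∅ Set.univ (by simp)
    rw [Set.empty_union, huniv] at h1
    by_contra h
    have h2 : (1 : ℝ≥0∞) < 1 + m ∅ := ENNReal.lt_add_right (by simp) h
    rw [add_comm, ← h1] at h2
    exact lt_irrefl _ h2
  -- All sets in sight are unions of fibres of the map recording which of them contain `x`.
  let T : X → Set I × Set I := fun x => ({i | x ∈ A i}, {i | x ∈ B i})
  let μ : Set I × Set I → ℝ≥0∞ := fun ω => m (T ⁻¹' {ω})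
  have hpre : ∀ s : Set (Set I × Set I), m (T ⁻¹' s) = ∑ ω, if ω ∈ s then μ ω else 0 := by
    intro s
    have := measure_preimage_eq_sum_fibers h0 hadd T (Finset.univ.filter (· ∈ s))
    rw [Finset.sum_filter] at this
    rw [← this]
    congr 1
    ext x
    simp
  have hA : ∑ i, m (A i) = ∑ ω : Set I × Set I, (ω.1.ncard : ℝ≥0∞) * μ ω := by
    have h : ∀ i, m (A i) = ∑ ω : Set I × Set I, if i ∈ ω.1 then μ ω else 0 :=
      fun i => hpre {ω | i ∈ ω.1}
    simp_rw [h]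
    rw [Finset.sum_comm]
    refine Finset.sum_congr rfl fun ω _ => ?_
    rw [← Finset.sum_filter, Finset.sum_const, nsmul_eq_mul, Set.ncard_eq_toFinset_card']
    congr 3
    ext i
    simp
  have hB : ∑ i, m (B i) = ∑ ω : Set I × Set I, (ω.2.ncard : ℝ≥0∞) * μ ω := by
    have h : ∀ i, m (B i) = ∑ ω : Set I × Set I, if i ∈ ω.2 then μ ω else 0 :=
      fun i => hpre {ω | i ∈ ω.2}
    simp_rw [h]
    rw [Finset.sum_comm]
    refine Finset.sum_congr rfl fun ω _ => ?_
    rw [← Finset.sum_filter, Finset.sum_const, nsmul_eq_mul, Set.ncard_eq_toFinset_card']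
    congr 3
    ext i
    simp
  have h1 : (1 : ℝ≥0∞) = ∑ ω, μ ω := by
    rw [← huniv]
    simpa using hpre Set.univ
  rw [hA, hB, h1, ← Finset.sum_add_distrib]
  refine Finset.sum_le_sum fun ω _ => ?_
  by_cases hω : ∃ x, T x = ω
  · obtain ⟨x, rfl⟩ := hω
    have := hAB x
    calc _ = ((T x).1.ncard + 1 : ℝ≥0∞) * μ (T x) := by ring
      _ ≤ _ := by
        gcongr
        exact_mod_cast this
  · have : μ ω = 0 := by
      have he : T ⁻¹' {ω} = ∅ := by
        ext x
        simpa using fun h => hω ⟨x, h⟩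
      simp only [μ, he, h0]
    simp [this]

variable {G : Type*} [Group G]

/-- An invariant mean annihilates differences of translates, so a sum of such differences of
bounded functions cannot be bounded below by a positive constant. After rounding, the functions
take values in a finite set of natural numbers, and only the measures of their superlevel sets
matter. -/
lemma IsAmenableGroup.not_forall_le_sum_sub (hG : IsAmenableGroup G) {I : Type*} [Fintype I]
    (s : I → G) (φ : I → G → ℝ) (B : ℝ) (hB : ∀ i g, |φ i g| ≤ B) (c : ℝ) (hc : 0 < c) :
    ¬ ∀ g, c ≤ ∑ i, (φ i (s i * g) - φ i g) := by
  intro H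
  obtain ⟨m, huniv, hadd, hinv⟩ := hG
  -- Scaling by `M` makes the lower bound exceed the total rounding error, one for each index.
  obtain ⟨M, hM⟩ := exists_nat_gt (Fintype.card I / c)
  rw [div_lt_iff₀ hc] at hM
  let ψ : I → G → ℕ := fun i g => ⌊M * (φ i g + B)⌋₊
  have hpos : ∀ i g, 0 ≤ φ i g + B := fun i g => by linarith [(abs_le.1 (hB i g)).1]
  obtain ⟨R, hR⟩ := exists_nat_gt (M * (B + B))
  have hψR : ∀ i g, ψ i g ≤ R := by
    intro i g
    refine Nat.floor_le_of_le (le_trans ?_ hR.le)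
    gcongr
    exact (abs_le.1 (hB i g)).2
  have hψ : ∀ g, ∑ i, ψ i g + 1 ≤ ∑ i, ψ i (s i * g) := by
    intro g
    rw [Nat.succ_le_iff]
    have h1 : ∀ i, (M * (φ i (s i * g) - φ i g) - 1 : ℝ) ≤ ψ i (s i * g) - ψ i g := by
      intro i
      have h2 := Nat.floor_le (mul_nonneg M.cast_nonneg (hpos i g))
      have h3 := Nat.lt_floor_add_one ((M : ℝ) * (φ i (s i * g) + B))
      simp only [ψ]
      linarith
    have h4 := Finset.sum_le_sum fun i (_ : i ∈ Finset.univ) => h1 i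
    rw [Finset.sum_sub_distrib, ← Finset.mul_sum,
      Finset.sum_sub_distrib (f := fun i => (ψ i _ : ℝ))] at h4
    have h5 : (0 : ℝ) < ∑ i, (ψ i (s i * g) : ℝ) - ∑ i, (ψ i g : ℝ) := by
      refine lt_of_lt_of_le ?_ h4
      have := mul_le_mul_of_nonneg_left (H g) M.cast_nonneg
      simp only [Finset.sum_const, Finset.card_univ, nsmul_eq_mul, mul_one]
      linarith
    have h6 : ((∑ i, ψ i g : ℕ) : ℝ) < (∑ i, ψ i (s i * g) : ℕ) := by
      push_cast
      linarith
    exact_mod_cast h6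
  have hcard : ∀ f : I → ℕ, (∀ i, f i ≤ R) →
      {p : I × Fin R | (p.2 : ℕ) < f p.1}.ncard = ∑ i, f i := by
    intro f hf
    classical
    rw [Set.ncard_eq_toFinset_card', Set.toFinset_ofPred, Finset.card_filter,
      ← Finset.univ_product_univ, Finset.sum_product]
    refine Finset.sum_congr rfl fun i _ => ?_
    rw [← Finset.card_filter]
    simp [Fin.card_filter_val_lt, min_eq_right (hf i)]
  let A : I × Fin R → Set G := fun p => {g | (p.2 : ℕ) < ψ p.1 g}
  have h8 := sum_measure_add_one_le huniv hadd A
      (fun p => {g | (p.2 : ℕ) < ψ p.1 (s p.1 * g)}) <| by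
    intro g
    have e1 := hcard (fun i => ψ i g) fun i => hψR i g
    have e2 := hcard (fun i => ψ i (s i * g)) fun i => hψR i _
    simp only [A, Set.mem_ofPred_eq]
    rw [e1, e2]
    exact hψ g
  have h9 : ∀ p : I × Fin R, m {g | (p.2 : ℕ) < ψ p.1 (s p.1 * g)} = m (A p) := by
    intro p
    rw [← hinv (s p.1)⁻¹ (A p)]
    congr 1
    ext g
    simp [A, Set.mem_inv_smul_set_iff]
  simp only [h9] at h8
  have hle : ∀ t : Set G, m t ≤ 1 := by
    intro t
    rw [← huniv, ← Set.union_compl_self t, hadd t tᶜ disjoint_compl_right]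
    exact le_self_add
  have hfin : ∑ p, m (A p) ≠ ∞ :=
    ENNReal.sum_ne_top.2 fun p _ => ((hle _).trans_lt ENNReal.one_lt_top).ne
  exact (ENNReal.lt_add_right hfin one_ne_zero).not_ge h8

/-- If no density were almost invariant, a hyperplane would separate `0` from the tuples of
differences `s · f - f`, and its coordinates would contradict the existence of an invariant
mean. -/
theorem IsAmenableGroup.hasAlmostInvariantVectors (hG : IsAmenableGroup G) :
    HasAlmostInvariantVectors G := by
  classical
  refine .of_finiteDensities fun S ε hε => ?_
  by_contra! H
  let D : lp (fun _ : G => ℝ) 1 →ₗ[ℝ] (S → lp (fun _ : G => ℝ) 1) :=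
    LinearMap.pi fun s => (lpTranslate ℝ 1 s.1).toLinearEquiv.toLinearMap - LinearMap.id
  have hD : ∀ f s, D f s = lpTranslate ℝ 1 s.1 f - f := fun f s => rfl
  have hmem : (0 : S → lp (fun _ : G => ℝ) 1) ∉ closure (D '' finiteDensities G) := by
    rw [Metric.mem_closure_iff]
    push Not
    refine ⟨ε, hε, ?_⟩
    rintro _ ⟨f, hf, rfl⟩
    obtain ⟨s, hs, h⟩ := H f hf
    rw [dist_zero_left]
    exact h.trans (by simpa [hD] using norm_le_pi_norm (D f) ⟨s, hs⟩)
  obtain ⟨Λ, u, hu0, hu⟩ := geometric_hahn_banach_point_closed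
    (convex_finiteDensities.linear_image D).closure isClosed_closure hmem
  rw [map_zero] at hu0
  refine hG.not_forall_le_sum_sub (I := S) (fun s => s.1)
    (fun s g => Λ (Pi.single s (lp.single 1 g 1))) ‖Λ‖ (fun s g => ?_) u hu0 fun g => ?_
  · refine (Λ.le_opNorm _).trans ?_
    rw [Pi.norm_single, lp.norm_single (by simp)]
    simp
  · refine (hu _ (subset_closure ⟨_, single_mem_finiteDensities g, rfl⟩)).le.trans_eq ?_
    rw [← Finset.univ_sum_single (D (lp.single 1 g 1)), map_sum]
    refine Finset.sum_congr rfl fun s _ => ?_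
    have h1 : lpTranslate ℝ 1 s.1 (lp.single 1 g (1 : ℝ)) = lp.single 1 (s.1 * g) (1 : ℝ) := by
      ext x
      simp [lp.single_apply, Pi.single_apply, inv_mul_eq_iff_eq_mul]
    rw [hD, h1, Pi.single_sub, map_sub]

/-- Amenability passes to quotients, by pushing the mean forward. -/
lemma IsAmenableGroup.of_surjective {H : Type*} [Group H] (hG : IsAmenableGroup G) (f : G →* H)
    (hf : Function.Surjective f) : IsAmenableGroup H := by
  obtain ⟨m, huniv, hadd, hinv⟩ := hG
  refine ⟨fun s => m (f ⁻¹' s), by simpa using huniv, fun s t hst => ?_, fun h s => ?_⟩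
  · exact hadd _ _ (hst.preimage f)
  · obtain ⟨g, rfl⟩ := hf h
    change m _ = m _
    rw [← hinv g (f ⁻¹' s)]
    congr 1
    ext x
    simp [Set.mem_smul_set_iff_inv_smul_mem]

end Amenable

/-! ### Representations induced from sums of characters -/

section Induced

/-- The matrix of a unitary operator on `ℂ^m`. -/
noncomputable def isometryToUnitaryMatrix (m : ℕ) :
    (EuclideanSpace ℂ (Fin m) ≃ₗᵢ[ℂ] EuclideanSpace ℂ (Fin m)) →*
      Matrix.unitaryGroup (Fin m) ℂ where
  toFun U := ⟨(Matrix.toEuclideanCLM (n := Fin m) (𝕜 := ℂ)).symm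
    (Unitary.linearIsometryEquiv.symm U : EuclideanSpace ℂ (Fin m) →L[ℂ] EuclideanSpace ℂ (Fin m)),
    by
      have h := (Unitary.linearIsometryEquiv.symm U).2
      have hs : ∀ T, star ((Matrix.toEuclideanCLM (n := Fin m) (𝕜 := ℂ)).symm T) =
          (Matrix.toEuclideanCLM (n := Fin m) (𝕜 := ℂ)).symm (star T) := fun T =>
        ((Matrix.toEuclideanCLM (n := Fin m) (𝕜 := ℂ)).symm.map_star' T).symm
      rw [Unitary.mem_iff] at h
      rw [Matrix.unitaryGroup, Unitary.mem_iff, hs, ← map_mul, ← map_mul, h.1, h.2, map_one]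
      exact ⟨rfl, rfl⟩⟩
  map_one' := Subtype.ext (by simp only [map_one, OneMemClass.coe_one])
  map_mul' U V := Subtype.ext (by simp only [map_mul, Submonoid.coe_mul])

lemma toEuclideanCLM_isometryToUnitaryMatrix {m : ℕ}
    (U : EuclideanSpace ℂ (Fin m) ≃ₗᵢ[ℂ] EuclideanSpace ℂ (Fin m)) :
    Matrix.toEuclideanCLM (n := Fin m) (𝕜 := ℂ) (isometryToUnitaryMatrix m U : Matrix _ _ ℂ) =
      (Unitary.linearIsometryEquiv.symm U :
        EuclideanSpace ℂ (Fin m) →L[ℂ] EuclideanSpace ℂ (Fin m)) := by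
  rw [isometryToUnitaryMatrix, MonoidHom.coe_mk, OneHom.coe_mk, StarAlgEquiv.apply_symm_apply]

variable {F : Type*} [Group F] {H : Subgroup F}

/-- The component `h ∈ H` in the decomposition `x = s h` of `x ∈ F`, where `s` is the chosen
representative of the coset `x H`. -/
noncomputable def cosetPart (H : Subgroup F) (x : F) : H :=
  ⟨(x : F ⧸ H).out⁻¹ * x, QuotientGroup.eq.1 (QuotientGroup.out_eq' _)⟩

lemma cosetPart_mul (x : F) (h : H) : cosetPart H (x * h) = cosetPart H x * h := by
  ext
  simp [cosetPart, mul_assoc]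

lemma cosetPart_out (c : F ⧸ H) : cosetPart H c.out = 1 := by
  ext
  simp [cosetPart]

/-- The unitary representation `⨁ᵢ χᵢ` of `H`, for characters `χ₁, …, χ_d`. -/
noncomputable def diagonalRep {d : ℕ} (χ : Fin d → H →* unitary ℂ) :
    H →* Matrix.unitaryGroup (Fin d) ℂ where
  toFun h := ⟨Matrix.diagonal fun i => (χ i h : ℂ), by
    rw [Matrix.mem_unitaryGroup_iff, Matrix.star_eq_conjTranspose, Matrix.diagonal_conjTranspose,
      Matrix.diagonal_mul_diagonal, ← Matrix.diagonal_one]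
    congr 1
    ext i
    exact Unitary.mul_star_self_of_mem (χ i h).2⟩
  map_one' := by ext; simp
  map_mul' h h' := by ext; simp

variable {d m : ℕ} (χ : Fin d → H →* unitary ℂ) (e : (F ⧸ H) × Fin d ≃ Fin m)

/-- The identification of `ℂ^m`, whose coordinates are indexed by pairs of a coset and a character,
with the space of the representation induced from `⨁ᵢ χᵢ`: a vector is the restriction of a
function to the chosen coset representatives. -/
noncomputable def inducedExtend : (Fin m → ℂ) →ₗ[ℂ] (F → Fin d → ℂ) where
  toFun v x i := (χ i (cosetPart H x)⁻¹ : ℂ) * v (e (x, i))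
  map_add' v w := by ext; simp [mul_add]
  map_smul' c v := by ext; simp; ring

lemma inducedExtend_apply (v : Fin m → ℂ) (x : F) (i : Fin d) :
    inducedExtend χ e v x i = (χ i (cosetPart H x)⁻¹ : ℂ) * v (e (x, i)) := rfl

lemma inducedExtend_mul (v : Fin m → ℂ) (x : F) (h : H) (i : Fin d) :
    inducedExtend χ e v (x * h) i = (χ i h⁻¹ : ℂ) * inducedExtend χ e v x i := by
  simp only [inducedExtend_apply, cosetPart_mul, QuotientGroup.mk_mul_of_mem x h.2, mul_inv_rev,
    map_mul, Submonoid.coe_mul, mul_assoc]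

lemma inducedExtend_out (v : Fin m → ℂ) (c : F ⧸ H) (i : Fin d) :
    inducedExtend χ e v c.out i = v (e (c, i)) := by
  simp [inducedExtend_apply, cosetPart_out]

lemma range_inducedExtend :
    LinearMap.range (inducedExtend χ e) = inducedSpace (diagonalRep χ) := by
  have hdiag : ∀ (h : H) (ξ : Fin d → ℂ) (i : Fin d),
      ((diagonalRep χ h : Matrix (Fin d) (Fin d) ℂ) *ᵥ ξ) i = (χ i h : ℂ) * ξ i :=
    fun h ξ i => Matrix.mulVec_diagonal _ _ _
  ext ξ
  constructor
  · rintro ⟨v, rfl⟩ x h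
    ext i
    rw [hdiag, inducedExtend_mul]
  · intro hξ
    refine ⟨fun k => ξ (e.symm k).1.out (e.symm k).2, ?_⟩
    ext x i
    have hx : x = (x : F ⧸ H).out * (cosetPart H x : F) := by simp [cosetPart]
    have h1 := congrFun (hξ (x : F ⧸ H).out (cosetPart H x)) i
    rw [← hx, hdiag] at h1
    simp [inducedExtend_apply, h1]

/-- Translation by `g` on the induced representation, in the coordinates of `inducedExtend`. -/
noncomputable def inducedTranslate (g : F) : (Fin m → ℂ) →ₗ[ℂ] (Fin m → ℂ) where
  toFun v k := inducedExtend χ e v (g⁻¹ * (e.symm k).1.out) (e.symm k).2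
  map_add' v w := by ext; simp
  map_smul' c v := by ext; simp

lemma inducedTranslate_apply (g : F) (v : Fin m → ℂ) (k : Fin m) :
    inducedTranslate χ e g v k = inducedExtend χ e v (g⁻¹ * (e.symm k).1.out) (e.symm k).2 := rfl

lemma inducedExtend_inducedTranslate (g : F) (v : Fin m → ℂ) (x : F) :
    inducedExtend χ e (inducedTranslate χ e g v) x = inducedExtend χ e v (g⁻¹ * x) := by
  ext i
  have hx : g⁻¹ * x = g⁻¹ * (x : F ⧸ H).out * (cosetPart H x : F) := by
    simp [cosetPart, mul_assoc]
  rw [hx, inducedExtend_mul, inducedExtend_apply, inducedTranslate_apply, Equiv.symm_apply_apply]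

lemma inducedTranslate_mul (g h : F) (v : Fin m → ℂ) :
    inducedTranslate χ e (g * h) v = inducedTranslate χ e g (inducedTranslate χ e h v) := by
  ext k
  rw [inducedTranslate_apply, inducedTranslate_apply, inducedExtend_inducedTranslate, mul_inv_rev,
    mul_assoc]

lemma inducedTranslate_one (v : Fin m → ℂ) : inducedTranslate χ e 1 v = v := by
  ext k
  rw [inducedTranslate_apply, inv_one, one_mul, inducedExtend_out, Equiv.apply_symm_apply]

lemma norm_inducedTranslate (g : F) (v : EuclideanSpace ℂ (Fin m)) :
    ‖WithLp.toLp 2 (inducedTranslate χ e g v)‖ = ‖v‖ := by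
  rw [EuclideanSpace.norm_eq, EuclideanSpace.norm_eq]
  congr 1
  let p : Fin m ≃ Fin m :=
    e.symm.trans (((MulAction.toPerm g⁻¹).prodCongr (Equiv.refl (Fin d))).trans e)
  refine Eq.trans ?_ (p.sum_comp fun k => ‖v k‖ ^ 2)
  refine Finset.sum_congr rfl fun k _ => ?_
  congr 1
  change ‖inducedExtend χ e v _ _‖ = _
  rw [inducedExtend_apply, norm_mul, CStarRing.norm_coe_unitary, one_mul]
  have hc : ((g⁻¹ * (e.symm k).1.out : F) : F ⧸ H) = g⁻¹ • (e.symm k).1 := by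
    conv_rhs => rw [← QuotientGroup.out_eq' (e.symm k).1]
    rfl
  rw [hc]
  rfl

/-- The representation of `F` induced from the representation `⨁ᵢ χᵢ` of `H`, as unitary operators
on `ℂ^m`. -/
noncomputable def inducedRep : F →* (EuclideanSpace ℂ (Fin m) ≃ₗᵢ[ℂ] EuclideanSpace ℂ (Fin m)) where
  toFun g :=
    { toFun := fun v => WithLp.toLp 2 (inducedTranslate χ e g v)
      invFun := fun v => WithLp.toLp 2 (inducedTranslate χ e g⁻¹ v)
      left_inv := fun v => by
        simp [← inducedTranslate_mul, inducedTranslate_one]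
      right_inv := fun v => by
        simp [← inducedTranslate_mul, inducedTranslate_one]
      map_add' := fun v w => by simp
      map_smul' := fun c v => by simp
      norm_map' := norm_inducedTranslate χ e g }
  map_one' := by
    ext v k
    exact congrFun (inducedTranslate_one χ e v) k
  map_mul' g h := by
    ext v k
    exact congrFun (inducedTranslate_mul χ e g h v) k

lemma inducedRep_apply (g : F) (v : EuclideanSpace ℂ (Fin m)) (k : Fin m) :
    inducedRep χ e g v k = inducedExtend χ e v (g⁻¹ * (e.symm k).1.out) (e.symm k).2 := rfl

lemma isInducedRep_inducedRep [Finite F] :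
    IsInducedRep (diagonalRep χ) ((isometryToUnitaryMatrix m).comp (inducedRep χ e)) := by
  refine ⟨inducedExtend χ e, range_inducedExtend χ e, fun v w => ?_, fun g v x => ?_⟩
  · classical
    have := Fintype.ofFinite (F ⧸ H)
    rw [finsum_eq_sum_of_fintype]
    simp only [dotProduct, Pi.star_apply, inducedExtend_out]
    rw [← e.sum_comp, Fintype.sum_prod_type]
  · rw [← inducedExtend_inducedTranslate]
    have h := congrArg (fun A => (A (WithLp.toLp 2 v)).ofLp)
      (toEuclideanCLM_isometryToUnitaryMatrix (inducedRep χ e g))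
    rw [Matrix.ofLp_toEuclideanCLM] at h
    exact congrArg (fun w => inducedExtend χ e w x) h

/-- Central elements of `F` that lie in `H` act diagonally on the induced representation. -/
lemma inducedRep_apply_of_mem {g : F} (hg : g ∈ H) (hc : g ∈ Subgroup.center F)
    (v : EuclideanSpace ℂ (Fin m)) (k : Fin m) :
    inducedRep χ e g v k = (χ (e.symm k).2 ⟨g, hg⟩ : ℂ) * v k := by
  have h1 : g⁻¹ * (e.symm k).1.out = (e.symm k).1.out * ((⟨g, hg⟩⁻¹ : H) : F) :=
    (Subgroup.mem_center_iff.1 (inv_mem hc) _).symm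
  rw [inducedRep_apply, h1, inducedExtend_mul, inducedExtend_out, inv_inv, Equiv.apply_symm_apply]

/-- Elements outside `H` move the coset `H`, so they have vanishing matrix coefficients between
vectors supported on this coset. -/
lemma inner_inducedRep_of_notMem {g : F} (hg : g ∉ H) (v w : EuclideanSpace ℂ (Fin m))
    (hv : ∀ k, (e.symm k).1 ≠ ((1 : F) : F ⧸ H) → v k = 0)
    (hw : ∀ k, (e.symm k).1 ≠ ((1 : F) : F ⧸ H) → w k = 0) :
    inner ℂ v (inducedRep χ e g w) = 0 := by
  rw [PiLp.inner_apply]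
  refine Finset.sum_eq_zero fun k _ => ?_
  by_cases hk : (e.symm k).1 = ((1 : F) : F ⧸ H)
  · have h1 : inducedRep χ e g w k = 0 := by
      rw [inducedRep_apply, inducedExtend_apply, hw, mul_zero]
      rw [Equiv.symm_apply_apply]
      intro h2
      apply hg
      have h3 : ((1 : F) : F ⧸ H) = (((1 : F) : F ⧸ H).out : F) := (QuotientGroup.out_eq' _).symm
      rw [eq_comm, QuotientGroup.eq, hk, inv_one, one_mul] at h2
      rw [QuotientGroup.eq, inv_one, one_mul] at h3
      simpa using (H.mul_mem_cancel_right h3).1 h2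
    rw [h1, inner_zero_right]
  · rw [hv k hk, inner_zero_left]

end Induced

/-! ### Weights on the dual of a finite abelian group -/

section CharacterWeights

variable {A : Type*} [AddCommGroup A] [Fintype A]

/-- The squared modulus of the Fourier transform of the finitely supported measure
`∑ n ∈ s, a n • δ_(q n)` on a finite abelian group, normalised by the order of the group. -/
noncomputable def charWeight {I : Type*} (s : Finset I) (a : I → ℝ) (q : I → A)
    (ψ : AddChar A ℂ) : ℝ :=
  (Fintype.card A : ℝ)⁻¹ * ‖∑ n ∈ s, (a n : ℂ) * ψ (q n)‖ ^ 2

lemma charWeight_nonneg {I : Type*} (s : Finset I) (a : I → ℝ) (q : I → A) (ψ : AddChar A ℂ) :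
    0 ≤ charWeight s a q ψ := by
  unfold charWeight
  positivity

/-- Fourier inversion for `charWeight`. -/
lemma sum_charWeight_mul [DecidableEq A] {I : Type*} (s : Finset I) (a : I → ℝ) (q : I → A)
    (z : A) :
    ∑ ψ, (charWeight s a q ψ : ℂ) * ψ z =
      ∑ n ∈ s, ∑ n' ∈ s, if q n + z = q n' then (a n * a n' : ℂ) else 0 := by
  have h1 : ∀ ψ : AddChar A ℂ, (charWeight s a q ψ : ℂ) * ψ z = ∑ n ∈ s, ∑ n' ∈ s,
      (a n * a n' : ℂ) * ((Fintype.card A : ℂ)⁻¹ * ψ (q n + z - q n')) := by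
    intro ψ
    have h2 : ((‖∑ n ∈ s, (a n : ℂ) * ψ (q n)‖ ^ 2 : ℝ) : ℂ) =
        (∑ n ∈ s, (a n : ℂ) * ψ (q n)) * ∑ n ∈ s, (a n : ℂ) * ψ (-q n) := by
      push_cast
      rw [← Complex.mul_conj', map_sum]
      simp [AddChar.map_neg_eq_conj]
    rw [charWeight, Complex.ofReal_mul, h2, Finset.sum_mul_sum, Finset.mul_sum, Finset.sum_mul]
    refine Finset.sum_congr rfl fun n _ => ?_
    rw [Finset.mul_sum, Finset.sum_mul]
    refine Finset.sum_congr rfl fun n' _ => ?_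
    rw [sub_eq_add_neg, AddChar.map_add_eq_mul, AddChar.map_add_eq_mul]
    push_cast
    ring
  simp_rw [h1]
  rw [Finset.sum_comm]
  refine Finset.sum_congr rfl fun n _ => ?_
  rw [Finset.sum_comm]
  refine Finset.sum_congr rfl fun n' _ => ?_
  rw [← Finset.mul_sum, ← Finset.mul_sum, AddChar.sum_apply_eq_ite]
  have hA : (Fintype.card A : ℂ) ≠ 0 := by simp
  simp only [sub_eq_zero]
  split_ifs
  · rw [inv_mul_cancel₀ hA, mul_one]
  · simp

/-- If a probability measure `p` on the dual group has Fourier coefficients close to `1` on a finite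
set `T`, then most characters are close to `1` on `T`. Replacing the others by the trivial
character changes all Fourier coefficients of `p` only little. -/
lemma exists_replace_characters (p : AddChar A ℂ → ℝ) (hp : ∀ ψ, 0 ≤ p ψ) (hp1 : ∑ ψ, p ψ = 1)
    (T : Finset A) {η ε : ℝ} (hε : 0 < ε)
    (hT : ∀ t ∈ T, 2 - 2 * (∑ ψ, (p ψ : ℂ) * ψ t).re ≤ η) :
    ∃ r : AddChar A ℂ → AddChar A ℂ, (∀ ψ, ∀ t ∈ T, ‖r ψ t - 1‖ ≤ ε) ∧
      ∀ z, ‖∑ ψ, (p ψ : ℂ) * r ψ z - ∑ ψ, (p ψ : ℂ) * ψ z‖ ≤ 2 * (T.card * η / ε ^ 2) := by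
  classical
  let good : AddChar A ℂ → Prop := fun ψ => ∀ t ∈ T, ‖ψ t - 1‖ ≤ ε
  refine ⟨fun ψ => if good ψ then ψ else 1, fun ψ t ht => ?_, fun z => ?_⟩
  · by_cases h : good ψ
    · simpa [h] using h t ht
    · simp [h, hε.le]
  · -- Chebyshev's inequality bounds the weight of the characters that are not close to `1`.
    have hbad : ∀ ψ, (if good ψ then 0 else p ψ) ≤ ∑ t ∈ T, p ψ * ‖ψ t - 1‖ ^ 2 / ε ^ 2 := by
      intro ψ
      have hnn : ∀ t ∈ T, 0 ≤ p ψ * ‖ψ t - 1‖ ^ 2 / ε ^ 2 := fun t _ => by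
        have := hp ψ
        positivity
      split_ifs with h
      · exact Finset.sum_nonneg hnn
      · simp only [good, not_forall, not_le] at h
        obtain ⟨t, ht, h⟩ := h
        refine le_trans ?_ (Finset.single_le_sum hnn ht)
        rw [le_div_iff₀ (by positivity)]
        exact mul_le_mul_of_nonneg_left (by gcongr) (hp ψ)
    have hsq : ∀ t ∈ T, ∑ ψ, p ψ * ‖ψ t - 1‖ ^ 2 ≤ η := by
      intro t ht
      refine le_of_eq_of_le ?_ (hT t ht)
      have h2 : ∀ ψ : AddChar A ℂ, p ψ * ‖ψ t - 1‖ ^ 2 = 2 * p ψ - 2 * ((p ψ : ℂ) * ψ t).re := by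
        intro ψ
        have h3 := AddChar.norm_apply ψ t
        have h4 : ‖ψ t‖ ^ 2 = 1 := by rw [h3, one_pow]
        rw [← Complex.normSq_eq_norm_sq, Complex.normSq_apply] at h4 ⊢
        simp only [Complex.sub_re, Complex.one_re, Complex.sub_im, Complex.one_im,
          Complex.re_ofReal_mul]
        linear_combination p ψ * h4
      simp_rw [h2]
      rw [Finset.sum_sub_distrib, ← Finset.mul_sum, hp1, ← Finset.mul_sum, Complex.re_sum, mul_one]
    have htot : ∑ ψ, (if good ψ then 0 else p ψ) ≤ T.card * η / ε ^ 2 := by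
      refine (Finset.sum_le_sum fun ψ _ => hbad ψ).trans ?_
      rw [Finset.sum_comm]
      simp_rw [← Finset.sum_div]
      gcongr
      refine (Finset.sum_le_sum hsq).trans_eq ?_
      simp
    rw [← Finset.sum_sub_distrib]
    refine (norm_sum_le _ _).trans ?_
    refine le_trans ?_ (mul_le_mul_of_nonneg_left htot zero_le_two)
    rw [Finset.mul_sum]
    refine Finset.sum_le_sum fun ψ _ => ?_
    by_cases h : good ψ
    · simp [h]
    · simp only [h, if_false]
      rw [← mul_sub, norm_mul, Complex.norm_of_nonneg (hp ψ), mul_comm]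
      refine mul_le_mul_of_nonneg_right ((norm_sub_le _ _).trans ?_) (hp ψ)
      rw [AddChar.norm_apply, AddChar.norm_apply]
      norm_num

/-- A character of a finite abelian group, with values in the unitary complex numbers. -/
noncomputable def AddChar.toUnitary {Z : Type*} [CommGroup Z] [Finite Z]
    (ψ : AddChar (Additive Z) ℂ) : Z →* unitary ℂ where
  toFun z := ⟨ψ (Additive.ofMul z), by
    have h : ‖ψ (Additive.ofMul z)‖ = 1 := AddChar.norm_apply ψ _
    rw [Unitary.mem_iff, mul_comm _ (star _), and_self]
    change (starRingEnd ℂ) _ * _ = 1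
    rw [RCLike.conj_mul, h]
    simp⟩
  map_one' := Subtype.ext (by simp)
  map_mul' z z' := Subtype.ext (by simp [AddChar.map_add_eq_mul])

end CharacterWeights

/-! ### Finite-dimensional representations that are almost trivial exactly on a central subgroup -/

section Approximation

/-- In a residually finite group finitely many nontrivial elements survive in a common finite
quotient. -/
lemma exists_finiteIndexNormalSubgroup_forall_notMem {Γ : Type*} [Group Γ]
    [Group.ResiduallyFinite Γ] (B : Finset Γ) :
    ∃ L : FiniteIndexNormalSubgroup Γ, ∀ b ∈ B, b ∈ L → b = 1 := by
  classical
  induction B using Finset.induction_on with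
  | empty => exact ⟨FiniteIndexNormalSubgroup.ofSubgroup ⊤, by simp⟩
  | insert b B _ ih =>
    obtain ⟨L, hL⟩ := ih
    by_cases hb : b = 1
    · refine ⟨L, fun c hc hcL => ?_⟩
      rcases Finset.mem_insert.1 hc with rfl | hc
      · exact hb
      · exact hL c hc hcL
    · obtain ⟨L', hL'⟩ := Group.exists_finiteIndexNormalSubgroup_notMem b hb
      refine ⟨L ⊓ L', fun c hc hcL => ?_⟩
      have h1 : c ∈ L ∧ c ∈ L' := hcL
      rcases Finset.mem_insert.1 hc with rfl | hc
      · exact absurd h1.2 hL'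
      · exact hL c hc h1.1

/-- The almost invariance of a unit vector is an estimate on its autocorrelation. -/
lemma two_sub_two_mul_sum_eq {N : Type*} [Group N] {a : N → ℝ} {s : Finset N}
    (hs : Function.support a ⊆ s) (ha : ∑' n, a n ^ 2 = 1) (t : N) :
    2 - 2 * ∑ n ∈ s, a n * a (t⁻¹ * n) = ∑' n, (a (t⁻¹ * n) - a n) ^ 2 := by
  have hfin : (Function.support a).Finite := s.finite_toSet.subset hs
  have h1 : Summable fun n => a n ^ 2 :=
    summable_of_hasFiniteSupport (hfin.subset fun n hn => by simpa using hn)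
  have h2 : Summable fun n => a (t⁻¹ * n) ^ 2 := (Equiv.mulLeft t⁻¹).summable_iff.2 h1
  have h3 : Summable fun n => a n * a (t⁻¹ * n) :=
    summable_of_hasFiniteSupport (hfin.subset fun n hn => by
      simp only [Function.mem_support] at hn ⊢
      exact left_ne_zero_of_mul hn)
  have h4 : ∑' n, a (t⁻¹ * n) ^ 2 = 1 := by
    rw [← ha]
    exact (Equiv.mulLeft t⁻¹).tsum_eq fun n => a n ^ 2
  have h5 : ∑' n, a n * a (t⁻¹ * n) = ∑ n ∈ s, a n * a (t⁻¹ * n) :=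
    tsum_eq_sum fun n hn => by
      rw [Function.notMem_support.1 fun h => hn (hs h), zero_mul]
  have h6 : ∀ n, (a (t⁻¹ * n) - a n) ^ 2 =
      a (t⁻¹ * n) ^ 2 + a n ^ 2 - 2 * (a n * a (t⁻¹ * n)) := fun n => by ring
  simp_rw [h6]
  rw [(h2.add h1).tsum_sub (h3.mul_left 2), h2.tsum_add h1, tsum_mul_left, h4, ha, h5]
  norm_num

lemma EuclideanSpace.norm_le_mul_norm {ι : Type*} [Fintype ι] {u w : EuclideanSpace ℂ ι} {ε : ℝ}
    (hε : 0 ≤ ε) (h : ∀ k, ‖u k‖ ≤ ε * ‖w k‖) : ‖u‖ ≤ ε * ‖w‖ := by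
  refine (sq_le_sq₀ (norm_nonneg _) (by positivity)).1 ?_
  rw [mul_pow, EuclideanSpace.norm_sq_eq, EuclideanSpace.norm_sq_eq, Finset.mul_sum]
  refine Finset.sum_le_sum fun k _ => ?_
  rw [← mul_pow]
  exact pow_le_pow_left₀ (norm_nonneg _) (h k) 2

/-- The key approximation. The weight `|â|²` on the dual of the image `H` of `N` in a finite
quotient of `Γ`, for a finitely supported almost invariant unit vector `a` on `N`, has Fourier
coefficients close to `1` at the given elements of `N` and equal to `0` at those other given
elements whose image lies in `H`. The sum of the characters of `H` close to `1` at the given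
elements of `N`, induced to the finite quotient, is then almost trivial there, and the weight
provides vectors whose matrix coefficients almost vanish at the given elements outside `N`. -/
theorem exists_almost_trivial_on_central {Γ : Type*} [Group Γ] [Group.ResiduallyFinite Γ]
    (N : Subgroup Γ) (hN : N ≤ Subgroup.center Γ) (E : Finset Γ) {ε : ℝ} (hε : 0 < ε) (r : ℕ) :
    ∃ m : ℕ, r ≤ m ∧
      ∃ (U : Γ →* (EuclideanSpace ℂ (Fin m) ≃ₗᵢ[ℂ] EuclideanSpace ℂ (Fin m)))
        (v : Fin r → EuclideanSpace ℂ (Fin m)),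
        IsInducedFromCentralOfFiniteQuotient ((isometryToUnitaryMatrix m).comp U) ∧
        Orthonormal ℂ v ∧
        (∀ x ∈ E, x ∈ N → ∀ w, ‖U x w - w‖ ≤ ε * ‖w‖) ∧
        ∀ x ∈ E, x ∉ N → ∀ i j, ‖inner ℂ (v i) (U x (v j))‖ ≤ ε := by
  classical
  have hcomm : ∀ (n : N) (x : Γ), (n : Γ) * x = x * n := fun n x =>
    (Subgroup.mem_center_iff.1 (hN n.2) x).symm
  set EN : Finset N := E.subtype (· ∈ N) with hEN
  -- By Chebyshev's inequality the characters to be replaced have weight at most `|EN| η / ε²`.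
  set η : ℝ := ε ^ 3 / (2 * (EN.card + 1)) with hη
  have hη0 : 0 < η := by positivity
  obtain ⟨a, hafin, ha1, hainv⟩ := HasAlmostInvariantVectors.of_commute
    (fun x y : N => Subtype.ext (hcomm x y)) (EN.image (·⁻¹)) η hη0
  set s : Finset N := hafin.toFinset with hs
  have hsupp : Function.support a ⊆ s := by simp [hs]
  obtain ⟨L, hL⟩ := exists_finiteIndexNormalSubgroup_forall_notMem
    (((s ×ˢ s) ×ˢ insert 1 E).image fun t => (t.1.1 : Γ) * t.2 * (t.1.2 : Γ)⁻¹)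
  let F := Γ ⧸ L.toSubgroup
  let pr : Γ →* F := QuotientGroup.mk' L.toSubgroup
  have hprsurj : Function.Surjective pr := QuotientGroup.mk'_surjective _
  have : Finite F := inferInstanceAs (Finite (Γ ⧸ L.toSubgroup))
  let H : Subgroup F := N.map pr
  have hHc : H ≤ Subgroup.center F := by
    rintro _ ⟨n, hn, rfl⟩
    refine Subgroup.mem_center_iff.2 fun y => ?_
    obtain ⟨x, rfl⟩ := hprsurj y
    rw [← map_mul, ← map_mul, hcomm ⟨n, hn⟩ x]
  let _ : CommGroup H :=
    { (inferInstance : Group H) with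
      mul_comm := fun x y => Subtype.ext (Subgroup.mem_center_iff.1 (hHc y.2) x) }
  let _ : Fintype (Additive H) := Fintype.ofFinite _
  let q : N → Additive H := fun n => Additive.ofMul ⟨pr n, n, n.2, rfl⟩
  -- `L` separates all elements that enter the Fourier coefficients of the weight.
  have hcoeff : ∀ (x : Γ) (hx : pr x ∈ H), x ∈ insert 1 E →
      ∑ ψ, (charWeight s a q ψ : ℂ) * ψ (Additive.ofMul ⟨pr x, hx⟩) =
        ∑ n ∈ s, ∑ n' ∈ s, if (n : Γ) * x = n' then (a n * a n' : ℂ) else 0 := by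
    intro x hx hxE
    rw [sum_charWeight_mul]
    refine Finset.sum_congr rfl fun n hn => Finset.sum_congr rfl fun n' hn' => ?_
    have hiff : q n + Additive.ofMul ⟨pr x, hx⟩ = q n' ↔ (n : Γ) * x = n' := by
      have h1 : q n + Additive.ofMul ⟨pr x, hx⟩ = q n' ↔ pr (n * x) = pr n' := by
        rw [map_mul]
        exact Subtype.ext_iff
      rw [h1]
      refine ⟨fun h => ?_, fun h => by rw [h]⟩
      have h2 : (n : Γ) * x * (n' : Γ)⁻¹ ∈ L := by
        have h3 : pr ((n : Γ) * x * (n' : Γ)⁻¹) = 1 := by rw [map_mul, h, map_inv, mul_inv_cancel]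
        exact (QuotientGroup.eq_one_iff _).1 h3
      exact mul_inv_eq_one.1 (hL _ (Finset.mem_image.2
        ⟨((n, n'), x), by simp [hn, hn', hxE] , rfl⟩) h2)
    simp only [hiff]
  have hcoeffN : ∀ t : N, (t : Γ) ∈ insert 1 E →
      ∑ ψ, (charWeight s a q ψ : ℂ) * ψ (q t) = ((∑ n ∈ s, a n * a (t * n) : ℝ) : ℂ) := by
    intro t ht
    refine (hcoeff t ⟨t, t.2, rfl⟩ ht).trans ?_
    push_cast
    refine Finset.sum_congr rfl fun n _ => ?_
    have h1 : ∀ n' : N, (n : Γ) * t = n' ↔ t * n = n' := by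
      intro n'
      rw [hcomm, Subtype.ext_iff]
      rfl
    simp only [h1, Finset.sum_ite_eq]
    split_ifs with h
    · rfl
    · rw [Function.notMem_support.1 fun h' => h (hsupp h')]
      simp
  have hp1 : ∑ ψ, charWeight s a q ψ = 1 := by
    have h1 := hcoeffN 1 (by simp)
    have h2 : q 1 = 0 := congrArg Additive.ofMul (Subtype.ext (map_one pr))
    simp only [h2, AddChar.map_zero_eq_one, mul_one, one_mul] at h1
    have h3 : ∑ ψ, charWeight s a q ψ = ∑ n ∈ s, a n * a n := by exact_mod_cast h1
    rw [h3, ← ha1, tsum_eq_sum (s := s) fun n hn => by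
      rw [Function.notMem_support.1 fun h => hn (hsupp h)]; simp]
    simp only [sq]
  obtain ⟨ρ, hρ1, hρ2⟩ := exists_replace_characters (charWeight s a q) (charWeight_nonneg s a q)
    hp1 (EN.image q) (η := η) hε (by
      intro t ht
      obtain ⟨n, hn, rfl⟩ := Finset.mem_image.1 ht
      have hnE : (n : Γ) ∈ E := by simpa [hEN] using hn
      have h1 := two_sub_two_mul_sum_eq hsupp ha1 n⁻¹
      rw [inv_inv] at h1
      rw [hcoeffN n (Finset.mem_insert_of_mem hnE), Complex.ofReal_re, h1]
      simpa using hainv n⁻¹ (Finset.mem_image_of_mem _ hn))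
  have hsmall : 2 * ((EN.image q).card * η / ε ^ 2) ≤ ε := by
    have h1 : ((EN.image q).card : ℝ) ≤ EN.card := by exact_mod_cast Finset.card_image_le
    have h2 : η * (2 * (EN.card + 1)) = ε ^ 3 := by
      rw [hη]
      field_simp
    rw [← mul_div_assoc, div_le_iff₀ (by positivity)]
    nlinarith
  -- Each character occurs `r` times, once for each of the vectors to be constructed.
  let ι := AddChar (Additive H) ℂ × Fin r
  let d := Fintype.card ι
  let eι : ι ≃ Fin d := Fintype.equivFin ι
  let _ : Fintype (F ⧸ H) := Fintype.ofFinite _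
  let m := Fintype.card ((F ⧸ H) × Fin d)
  let e : (F ⧸ H) × Fin d ≃ Fin m := Fintype.equivFin _
  let χ : Fin d → H →* unitary ℂ := fun k => (ρ (eι.symm k).1).toUnitary
  let v : Fin r → EuclideanSpace ℂ (Fin m) := fun j => WithLp.toLp 2 fun k =>
    if (e.symm k).1 = ((1 : F) : F ⧸ H) ∧ (eι.symm (e.symm k).2).2 = j then
      (√(charWeight s a q (eι.symm (e.symm k).2).1) : ℂ) else 0
  have hvsupp : ∀ j k, (e.symm k).1 ≠ ((1 : F) : F ⧸ H) → v j k = 0 := fun j k hk => by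
    simp [v, hk]
  have hinner : ∀ (i j : Fin r) (μ : AddChar (Additive H) ℂ → ℂ) (w : EuclideanSpace ℂ (Fin m)),
      (∀ k, w k = μ (eι.symm (e.symm k).2).1 * v j k) →
      inner ℂ (v i) w = if i = j then ∑ ψ, (charWeight s a q ψ : ℂ) * μ ψ else 0 := by
    intro i j μ w hw
    rw [PiLp.inner_apply, ← e.sum_comp, Fintype.sum_prod_type,
      Finset.sum_eq_single ((1 : F) : F ⧸ H), ← eι.sum_comp, Fintype.sum_prod_type]
    · have h1 : ∀ (ψ : AddChar (Additive H) ℂ) (j' : Fin r),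
          inner ℂ (v i (e (((1 : F) : F ⧸ H), eι (ψ, j')))) (w (e (((1 : F) : F ⧸ H), eι (ψ, j'))))
            = if j' = i then (if i = j then (charWeight s a q ψ : ℂ) * μ ψ else 0) else 0 := by
        intro ψ j'
        have h2 : ((√(charWeight s a q ψ) : ℝ) : ℂ) * (√(charWeight s a q ψ) : ℝ) =
            charWeight s a q ψ := by
          rw [← Complex.ofReal_mul, Real.mul_self_sqrt (charWeight_nonneg s a q ψ)]
        rw [hw]
        by_cases hi : j' = i
        · subst hi
          by_cases hj : j' = j
          · subst hj
            simp only [v, Equiv.symm_apply_apply, and_self, if_true, RCLike.inner_apply,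
              Complex.conj_ofReal]
            rw [mul_assoc, h2, mul_comm]
          · simp [v, hj]
        · simp [v, hi]
      simp only [h1, Finset.sum_ite_eq', Finset.mem_univ, if_true]
      split_ifs <;> simp
    · intro c _ hc
      refine Finset.sum_eq_zero fun k _ => ?_
      rw [hvsupp i _ (by simpa using hc), inner_zero_left]
    · simp
  have hortho : Orthonormal ℂ v := by
    rw [orthonormal_iff_ite]
    intro i j
    rw [hinner i j (fun _ => 1) (v j) fun k => (one_mul _).symm]
    simp only [mul_one, ← Complex.ofReal_sum, hp1, Complex.ofReal_one]
  refine ⟨m, ?_, (inducedRep χ e).comp pr, v, ?_, hortho, ?_, ?_⟩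
  · have h1 := hortho.linearIndependent.fintype_card_le_finrank
    rwa [finrank_euclideanSpace_fin, Fintype.card_fin] at h1
  · exact ⟨L, H, d, diagonalRep χ, _, hHc, isInducedRep_inducedRep χ e, rfl⟩
  · intro x hxE hxN w
    refine EuclideanSpace.norm_le_mul_norm hε.le fun k => ?_
    have hxH : pr x ∈ H := ⟨x, hxN, rfl⟩
    have h1 : (inducedRep χ e).comp pr x w k = (χ (e.symm k).2 ⟨pr x, hxH⟩ : ℂ) * w k :=
      inducedRep_apply_of_mem χ e hxH (hHc hxH) w k
    rw [PiLp.sub_apply, h1, ← sub_one_mul, norm_mul]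
    refine mul_le_mul_of_nonneg_right ?_ (norm_nonneg _)
    exact hρ1 _ _ (Finset.mem_image.2 ⟨⟨x, hxN⟩, by simpa [hEN] using hxE, rfl⟩)
  · intro x hxE hxN i j
    by_cases hxH : pr x ∈ H
    · refine (congrArg norm (hinner i j (fun ψ => ρ ψ (Additive.ofMul ⟨pr x, hxH⟩)) _ fun k =>
        inducedRep_apply_of_mem χ e hxH (hHc hxH) (v j) k)).trans_le ?_
      split_ifs
      · have h1 := hcoeff x hxH (Finset.mem_insert_of_mem hxE)
        have h2 : ∀ n n' : N, (n : Γ) * x ≠ n' := by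
          intro n n' h
          apply hxN
          rw [← eq_inv_mul_iff_mul_eq] at h
          rw [h]
          exact N.mul_mem (N.inv_mem n.2) n'.2
        simp only [h2, if_false, Finset.sum_const_zero] at h1
        have h3 := hρ2 (Additive.ofMul ⟨pr x, hxH⟩)
        rw [h1, sub_zero] at h3
        exact h3.trans hsmall
      · simpa using hε.le
    · have h1 : inner ℂ (v i) ((inducedRep χ e).comp pr x (v j)) = 0 :=
        inner_inducedRep_of_notMem χ e hxH _ _ (hvsupp i) (hvsupp j)
      rw [h1, norm_zero]
      exact hε.le

end Approximation

/-! ### Embedding into the unitary group of the corona -/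

section Corona

lemma norm_isometryToUnitaryMatrix_sub_one {m : ℕ}
    (U : EuclideanSpace ℂ (Fin m) ≃ₗᵢ[ℂ] EuclideanSpace ℂ (Fin m)) :
    ‖(isometryToUnitaryMatrix m U : Matrix (Fin m) (Fin m) ℂ) - 1‖ =
      ‖(Unitary.linearIsometryEquiv.symm U :
        EuclideanSpace ℂ (Fin m) →L[ℂ] EuclideanSpace ℂ (Fin m)) - 1‖ := by
  rw [← Matrix.l2_opNorm_toEuclideanCLM, map_sub, map_one,
    toEuclideanCLM_isometryToUnitaryMatrix]

/-- A single scale of the embedding: on a finite set the representation separates `N` from its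
complement in norm, and its dimension is as large as desired. -/
lemma exists_unitaryGroup_rep_of_central {Γ : Type*} [Group Γ] [Group.ResiduallyFinite Γ]
    (N : Subgroup Γ) (hN : N ≤ Subgroup.center Γ) (E : Finset Γ) {ε : ℝ} (hε : 0 < ε) (r : ℕ) :
    ∃ m : ℕ, r < m ∧ ∃ σ : Γ →* Matrix.unitaryGroup (Fin m) ℂ,
      IsInducedFromCentralOfFiniteQuotient σ ∧
      (∀ x ∈ E, x ∈ N → ‖(σ x : Matrix (Fin m) (Fin m) ℂ) - 1‖ ≤ ε) ∧
      ∀ x ∈ E, x ∉ N → 1 - ε ≤ ‖(σ x : Matrix (Fin m) (Fin m) ℂ) - 1‖ := by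
  obtain ⟨m, hm, U, v, hU, hv, h1, h2⟩ := exists_almost_trivial_on_central N hN E hε (r + 1)
  refine ⟨m, hm, _, hU, fun x hx hxN => ?_, fun x hx hxN => ?_⟩
  · rw [MonoidHom.comp_apply, norm_isometryToUnitaryMatrix_sub_one]
    exact ContinuousLinearMap.opNorm_le_bound _ hε.le (h1 x hx hxN)
  · rw [MonoidHom.comp_apply, norm_isometryToUnitaryMatrix_sub_one]
    set T := (Unitary.linearIsometryEquiv.symm (U x) :
      EuclideanSpace ℂ (Fin m) →L[ℂ] EuclideanSpace ℂ (Fin m)) - 1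
    have hT : inner ℂ (v 0) (T (v 0)) = inner ℂ (v 0) (U x (v 0)) - 1 := by
      have h3 : T (v 0) = U x (v 0) - v 0 := rfl
      rw [h3, inner_sub_right, inner_self_eq_norm_sq_to_K, hv.1 0]
      simp
    have h4 : ‖inner ℂ (v 0) (T (v 0))‖ ≤ ‖T‖ := by
      refine (norm_inner_le_norm _ _).trans ?_
      have h5 := T.le_opNorm (v 0)
      rw [hv.1 0, mul_one] at h5
      rwa [hv.1 0, one_mul]
    have h6 := norm_sub_norm_le (1 : ℂ) (inner ℂ (v 0) (U x (v 0)))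
    rw [norm_sub_rev, ← hT, norm_one] at h6
    linarith [h2 x hx hxN 0 0]

/-- The corona remembers exactly which sequences of representations become trivial in norm, and the
representations of `exists_unitaryGroup_rep_of_central` along an exhaustion of `Γ` do so precisely
on `N`. -/
theorem exists_embedding_of_central {Γ : Type*} [Group Γ] [Countable Γ] [Group.ResiduallyFinite Γ]
    (N : Subgroup Γ) [N.Normal] (hN : N ≤ Subgroup.center Γ) :
    ∃ n : ℕ → ℕ+, StrictMono n ∧
      ∃ σ : ∀ k, Γ →* Matrix.unitaryGroup (Fin (n k)) ℂ,
        (∀ k, IsInducedFromCentralOfFiniteQuotient (σ k)) ∧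
        ∃ Φ : Γ ⧸ N →* unitary (MatrixCorona n), Function.Injective Φ ∧
          ∀ x : Γ, ∃ a : MatrixProd n,
            (∀ k, a k = (σ k x : Matrix (Fin (n k)) (Fin (n k)) ℂ)) ∧
            (Φ (x : Γ ⧸ N) : MatrixCorona n) = MatrixCorona.mk n a := by
  classical
  obtain ⟨f, hf⟩ := exists_surjective_nat Γ
  let E : ℕ → Finset Γ := fun k => (Finset.range (k + 1)).image f
  have hE : ∀ x, ∀ᶠ k in atTop, x ∈ E k := by
    intro x
    obtain ⟨j, rfl⟩ := hf x
    filter_upwards [eventually_ge_atTop j] with k hk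
    exact Finset.mem_image_of_mem f (Finset.mem_range.2 (Nat.lt_succ_of_le hk))
  have hex := fun k r => exists_unitaryGroup_rep_of_central N hN (E k)
    (ε := 1 / ((k : ℝ) + 1)) (by positivity) r
  obtain ⟨n, hn, hP⟩ := extraction_forall_of_frequently
    (P := fun k m => 0 < m ∧ ∃ σ : Γ →* Matrix.unitaryGroup (Fin m) ℂ,
      IsInducedFromCentralOfFiniteQuotient σ ∧
      (∀ x ∈ E k, x ∈ N → ‖(σ x : Matrix (Fin m) (Fin m) ℂ) - 1‖ ≤ 1 / ((k : ℝ) + 1)) ∧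
      ∀ x ∈ E k, x ∉ N → 1 - 1 / ((k : ℝ) + 1) ≤ ‖(σ x : Matrix (Fin m) (Fin m) ℂ) - 1‖)
    (fun k => frequently_atTop.2 fun r => by
      obtain ⟨m, hm, σ, h⟩ := hex k r
      exact ⟨m, hm.le, r.zero_le.trans_lt hm, σ, h⟩)
  choose hpos σ hσ hσN hσN' using hP
  let n' : ℕ → ℕ+ := fun k => ⟨n k, hpos k⟩
  let a : Γ → MatrixProd n' := fun x => ⟨fun k => (σ k x : Matrix (Fin (n k)) (Fin (n k)) ℂ),
    memℓp_infty ⟨1, by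
      rintro _ ⟨k, rfl⟩
      have := Nonempty.intro (⟨0, hpos k⟩ : Fin (n k))
      exact (CStarRing.norm_coe_unitary (σ k x)).le⟩⟩
  have ha_one : a 1 = 1 := by
    ext1
    funext k
    simp [a]
    rfl
  have ha_mul : ∀ x y, a (x * y) = a x * a y := by
    intro x y
    ext1
    funext k
    simp [a]
    rfl
  have ha_star : ∀ x, star (a x) = a x⁻¹ := by
    intro x
    ext1
    funext k
    change star (σ k x : Matrix (Fin (n k)) (Fin (n k)) ℂ) = (σ k x⁻¹ : Matrix _ _ ℂ)
    rw [map_inv]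
    rfl
  let Ψ : Γ →* unitary (MatrixCorona n') :=
    { toFun := fun x => ⟨MatrixCorona.mk n' (a x), by
        rw [Unitary.mem_iff, MatrixCorona.star_mk, ← map_mul, ← map_mul, ha_star, ← ha_mul,
          ← ha_mul, inv_mul_cancel, mul_inv_cancel, ha_one, map_one, and_self]⟩
      map_one' := Subtype.ext ((congrArg (MatrixCorona.mk n') ha_one).trans (map_one _))
      map_mul' := fun x y => Subtype.ext
        ((congrArg (MatrixCorona.mk n') (ha_mul x y)).trans (map_mul (MatrixCorona.mk n') _ _)) }
  have hker : ∀ x, Ψ x = 1 ↔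
      Tendsto (fun k => ‖(σ k x : Matrix (Fin (n k)) (Fin (n k)) ℂ) - 1‖) atTop (𝓝 0) := by
    intro x
    rw [← MonoidHom.map_one Ψ, Subtype.ext_iff]
    change MatrixCorona.mk n' (a x) = MatrixCorona.mk n' (a 1) ↔ _
    rw [MatrixCorona.mk_eq_mk_iff, ha_one]
    rfl
  have hlim : Tendsto (fun k : ℕ => 1 / ((k : ℝ) + 1)) atTop (𝓝 0) :=
    tendsto_one_div_add_atTop_nhds_zero_nat
  have hle : N ≤ Ψ.ker := by
    intro x hx
    rw [MonoidHom.mem_ker, hker]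
    refine squeeze_zero' (Eventually.of_forall fun k => norm_nonneg _) ?_ hlim
    filter_upwards [hE x] with k hk
    exact hσN k x hk hx
  refine ⟨n', fun j k hjk => hn hjk, σ, hσ, QuotientGroup.lift N Ψ hle, ?_, fun x =>
    ⟨a x, fun k => rfl, rfl⟩⟩
  rw [injective_iff_map_eq_one]
  intro y
  induction y using QuotientGroup.induction_on with
  | H x =>
    intro hx
    rw [QuotientGroup.eq_one_iff]
    by_contra hxN
    have h1 := (hker x).1 hx
    have h2 : Tendsto (fun k : ℕ => 1 - 1 / ((k : ℝ) + 1)) atTop (𝓝 (1 - 0)) := hlim.const_sub 1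
    have h3 := le_of_tendsto_of_tendsto h2 h1 <| by
      filter_upwards [hE x] with k hk
      exact hσN' k x hk hxN
    norm_num at h3

end Corona

/-! ### Projections on a Hilbert space -/

section Projections

variable {H : Type*} [NormedAddCommGroup H] [InnerProductSpace ℂ H] [CompleteSpace H]

/-- If `Q` almost contains the finite-rank projection `P`, then a small perturbation of `Q` contains
it: replace the image `Q (ran P)` inside `ran Q` by `ran P`. -/
lemma exists_isStarProjection_ge_near {P Q : H →L[ℂ] H} (hP : IsStarProjection P)
    (hQ : IsStarProjection Q) (hPfin : FiniteDimensional ℂ P.range)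
    (hQfin : FiniteDimensional ℂ Q.range) {δ : ℝ} (hδ : δ ≤ 1 / 2) (h : ‖Q * P - P‖ ≤ δ) :
    ∃ Q' : H →L[ℂ] H, IsStarProjection Q' ∧ FiniteDimensional ℂ Q'.range ∧ P * Q' = P ∧
      ‖Q' - Q‖ ≤ 3 * δ := by
  have hPP : ∀ x, P (P x) = P x := fun x => congrArg (fun T => T x) hP.isIdempotentElem.eq
  have hQQ : ∀ x, Q (Q x) = Q x := fun x => congrArg (fun T => T x) hQ.isIdempotentElem.eq
  let W : Submodule ℂ H := P.range.map (Q : H →ₗ[ℂ] H)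
  have : FiniteDimensional ℂ W := inferInstanceAs (FiniteDimensional ℂ (P.range.map _))
  let R : H →L[ℂ] H := W.starProjection
  have hR : IsStarProjection R := isStarProjection_starProjection
  have hRmem : ∀ x, ∃ y, P y = y ∧ Q y = R x := by
    intro x
    obtain ⟨_, ⟨y, rfl⟩, hy⟩ : R x ∈ W := W.starProjection_apply_mem x
    exact ⟨P y, hPP y, hy⟩
  have hQR : Q * R = R := by
    ext x
    obtain ⟨y, -, hy⟩ := hRmem x
    rw [mul_apply_eq_comp, ← hy, hQQ]
  have hRQ : R * Q = R := by
    have := congrArg star hQR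
    rwa [star_mul, hQ.isSelfAdjoint.star_eq, hR.isSelfAdjoint.star_eq] at this
  have hRP : R * P = Q * P := by
    rw [← hRQ, mul_assoc]
    ext x
    exact Submodule.starProjection_eq_self_iff.2 ⟨P x, ⟨x, rfl⟩, rfl⟩
  have hzero : (Q - R) * P = 0 := by rw [sub_mul, hRP, sub_self]
  have hzero' : P * (Q - R) = 0 := by
    have := congrArg star hzero
    rwa [star_mul, star_sub, hQ.isSelfAdjoint.star_eq, hR.isSelfAdjoint.star_eq,
      hP.isSelfAdjoint.star_eq, star_zero] at this
  have h1 : ‖R * P - P‖ ≤ δ := by rwa [hRP]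
  have h2 : ‖P * R - P‖ ≤ δ := by
    rw [← norm_star, star_sub, star_mul, hR.isSelfAdjoint.star_eq, hP.isSelfAdjoint.star_eq]
    exact h1
  have h3 : ‖R - P * R‖ ≤ 2 * δ := by
    have hδ0 : 0 ≤ δ := (norm_nonneg _).trans h
    refine ContinuousLinearMap.opNorm_le_bound _ (by positivity) fun x => ?_
    obtain ⟨y, hy, hyx⟩ := hRmem x
    have h4 : ‖R x - y‖ ≤ δ * ‖y‖ := by
      have h5 := (Q * P - P).le_of_opNorm_le h y
      rwa [sub_apply, mul_apply_eq_comp, hy, hyx] at h5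
    have h6 : ‖R x‖ ≤ ‖x‖ := by
      have h7 := R.le_of_opNorm_le (IsStarProjection.norm_le R hR) x
      rwa [one_mul] at h7
    have h8 : ‖y‖ ≤ 2 * ‖R x‖ := by
      have h9 := norm_sub_norm_le y (R x)
      rw [norm_sub_rev] at h9
      nlinarith [norm_nonneg y]
    have h10 : (R - P * R) x = (1 - P) (R x - y) := by
      simp [hy]
    rw [h10]
    refine ((1 - P).le_of_opNorm_le (IsStarProjection.norm_le _ hP.one_sub) _).trans ?_
    nlinarith
  refine ⟨(Q - R) + P, (hR.sub_of_mul_eq_left hQ hRQ).add hP hzero, ?_, ?_, ?_⟩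
  · refine Submodule.finiteDimensional_of_le (S₂ := (Q.range ⊔ W) ⊔ P.range) ?_
    rintro _ ⟨x, rfl⟩
    exact Submodule.add_mem_sup (Submodule.sub_mem _ (Submodule.mem_sup_left ⟨x, rfl⟩)
      (Submodule.mem_sup_right (W.starProjection_apply_mem x))) ⟨x, rfl⟩
  · rw [mul_add, hzero', zero_add, hP.isIdempotentElem.eq]
  · have h11 : Q - R + P - Q = -((R - P * R) + (P * R - P)) := by abel
    rw [h11, norm_neg]
    exact (norm_add_le _ _).trans (by linarith)

/-- Strong convergence to the identity is uniform on the range of a finite-rank projection. -/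
lemma tendsto_norm_mul_sub_of_finiteDimensional {Q : ℕ → H →L[ℂ] H}
    (hQ : ∀ x, Tendsto (fun k => Q k x) atTop (𝓝 x)) {P : H →L[ℂ] H} (hP : IsStarProjection P)
    (hPfin : FiniteDimensional ℂ P.range) :
    Tendsto (fun k => ‖Q k * P - P‖) atTop (𝓝 0) := by
  let b := stdOrthonormalBasis ℂ P.range
  have hlim : Tendsto (fun k => ∑ i, ‖Q k (b i : H) - b i‖) atTop (𝓝 0) := by
    have : Tendsto (fun k => ∑ i, ‖Q k (b i : H) - b i‖) atTop (𝓝 (∑ _i, 0)) :=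
      tendsto_finsetSum _ fun i _ => tendsto_iff_norm_sub_tendsto_zero.1 (hQ (b i))
    simpa using this
  refine squeeze_zero (fun k => norm_nonneg _) (fun k => ?_) hlim
  refine ContinuousLinearMap.opNorm_le_bound _ (Finset.sum_nonneg fun _ _ => norm_nonneg _)
    fun x => ?_
  have h1 : P x = ∑ i, b.repr ⟨P x, ⟨x, rfl⟩⟩ i • (b i : H) := by
    have := congrArg (Submodule.subtype _) (b.sum_repr ⟨P x, ⟨x, rfl⟩⟩)
    rw [map_sum] at this
    exact this.symm
  have h2 : (Q k * P - P) x = ∑ i, b.repr ⟨P x, ⟨x, rfl⟩⟩ i • (Q k (b i : H) - b i) := by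
    change Q k (P x) - P x = _
    simp_rw [smul_sub, Finset.sum_sub_distrib, ← h1, ← map_smul, ← map_sum, ← h1]
  rw [h2, Finset.sum_mul]
  refine norm_sum_le_of_le _ fun i _ => ?_
  rw [norm_smul, mul_comm]
  refine mul_le_mul_of_nonneg_left ?_ (norm_nonneg _)
  refine (PiLp.norm_apply_le (b.repr ⟨P x, ⟨x, rfl⟩⟩) i).trans ?_
  rw [LinearIsometryEquiv.norm_map]
  exact (P.le_of_opNorm_le (IsStarProjection.norm_le P hP) x).trans_eq (one_mul _)

/-- The projections in the definition of quasidiagonality may be chosen increasing. -/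
lemma isQuasidiagonalSet_of_tendsto {Ω : Set (H →L[ℂ] H)} (Q : ℕ → H →L[ℂ] H)
    (hQ : ∀ k, IsStarProjection (Q k)) (hQfin : ∀ k, FiniteDimensional ℂ (Q k).range)
    (hQlim : ∀ x, Tendsto (fun k => Q k x) atTop (𝓝 x))
    (hQcomm : ∀ T ∈ Ω, Tendsto (fun k => ‖Q k * T - T * Q k‖) atTop (𝓝 0)) :
    IsQuasidiagonalSet Ω := by
  let Proj := {P : H →L[ℂ] H // IsStarProjection P ∧ FiniteDimensional ℂ P.range}
  have hnext : ∀ (P : Proj) (k : ℕ), ∃ P' : Proj, P.1 * P'.1 = P.1 ∧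
      ∃ l, k ≤ l ∧ ‖P'.1 - Q l‖ ≤ 1 / ((k : ℝ) + 1) := by
    rintro ⟨P, hP, hPfin⟩ k
    have hδ : (0 : ℝ) < min (1 / 2) (1 / (3 * ((k : ℝ) + 1))) := by positivity
    obtain ⟨l, hl, hkl⟩ := (((tendsto_norm_mul_sub_of_finiteDimensional hQlim hP hPfin).eventually
      (ge_mem_nhds hδ)).and (eventually_ge_atTop k)).exists
    obtain ⟨P', h1, h2, h3, h4⟩ := exists_isStarProjection_ge_near hP (hQ l) hPfin (hQfin l)
      (min_le_left _ _) hl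
    refine ⟨⟨P', h1, h2⟩, h3, l, hkl, h4.trans ?_⟩
    refine (mul_le_mul_of_nonneg_left (min_le_right _ _) (by norm_num)).trans_eq ?_
    field_simp
  choose f hf1 l hl hf2 using hnext
  let P : ℕ → Proj := fun k => Nat.rec (f ⟨0, .zero _, by
    rw [ContinuousLinearMap.toLinearMap_zero, LinearMap.range_zero]; infer_instance⟩ 0)
    (fun k P => f P (k + 1)) k
  have hstep : ∀ k, (P k).1 * (P (k + 1)).1 = (P k).1 := fun k => hf1 _ _
  have hnear : ∀ k, ∃ j, k ≤ j ∧ ‖(P k).1 - Q j‖ ≤ 1 / ((k : ℝ) + 1) := by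
    rintro (_ | k)
    · exact ⟨_, hl _ _, hf2 _ _⟩
    · exact ⟨_, hl _ _, hf2 _ _⟩
  choose j hj hPj using hnear
  have hjlim : Tendsto j atTop atTop := tendsto_atTop_mono hj tendsto_id
  have hε : Tendsto (fun k : ℕ => 1 / ((k : ℝ) + 1)) atTop (𝓝 0) :=
    tendsto_one_div_add_atTop_nhds_zero_nat
  refine ⟨fun k => (P k).1, fun k => (P k).2.1, fun k => ?_, fun k m hkm => ?_, fun x => ?_,
    fun T hT => ?_⟩
  · have := (P k).2.2
    have h1 := isCompactOperator_of_locallyCompactSpace_dom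
      ((P k).1.codRestrict (P k).1.range fun x => ⟨x, rfl⟩)
    exact h1.clm_comp (P k).1.range.subtypeL
  · induction m, hkm using Nat.le_induction with
    | base => exact (P k).2.1.isIdempotentElem.eq
    | succ m _ ih => rw [← ih, mul_assoc, hstep]
  · have h1 : Tendsto (fun k => ((P k).1 - Q (j k)) x) atTop (𝓝 0) := by
      refine squeeze_zero_norm (fun k => (ContinuousLinearMap.le_of_opNorm_le _ (hPj k) x)) ?_
      simpa using hε.mul_const ‖x‖
    have h2 := h1.add ((hQlim x).comp hjlim)
    simpa using h2
  · have h1 : Tendsto (fun k : ℕ => 2 * ‖T‖ * (1 / ((k : ℝ) + 1)) +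
        ‖Q (j k) * T - T * Q (j k)‖) atTop (𝓝 0) := by
      simpa using (hε.const_mul (2 * ‖T‖)).add ((hQcomm T hT).comp hjlim)
    refine squeeze_zero (fun k => norm_nonneg _) (fun k => ?_) h1
    have h2 : (P k).1 * T - T * (P k).1 =
        (((P k).1 - Q (j k)) * T - T * ((P k).1 - Q (j k))) + (Q (j k) * T - T * Q (j k)) := by
      noncomm_ring
    rw [h2]
    refine (norm_add_le _ _).trans (add_le_add_left ?_ _)
    refine (norm_sub_le _ _).trans ?_
    have h3 := (norm_mul_le ((P k).1 - Q (j k)) T).trans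
      (mul_le_mul_of_nonneg_right (hPj k) (norm_nonneg T))
    have h4 := (norm_mul_le T ((P k).1 - Q (j k))).trans
      (mul_le_mul_of_nonneg_left (hPj k) (norm_nonneg T))
    linarith

/-- Two orthonormal families that are orthogonal to each other are exchanged by a self-adjoint
unitary operator, the reflection in the orthogonal complement of all differences. It commutes with
every unitary operator that permutes the two families in the same way. -/
lemma exists_swap_orthonormal {ι : Type*} {b b' : ι → H} (hb : Orthonormal ℂ b)
    (hb' : Orthonormal ℂ b') (hbb' : ∀ i j, inner ℂ (b i) (b' j) = 0) :
    ∃ R : H ≃ₗᵢ[ℂ] H, (∀ i, R (b i) = b' i) ∧ (∀ x, R (R x) = x) ∧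
      ∀ (U : H ≃ₗᵢ[ℂ] H) (p : ι ≃ ι), (∀ i, U (b i) = b (p i)) → (∀ i, U (b' i) = b' (p i)) →
        ∀ x, R (U x) = U (R x) := by
  classical
  let D : Submodule ℂ H := Submodule.span ℂ (Set.range fun i => b i - b' i)
  refine ⟨Dᗮ.reflection, fun i => ?_, Dᗮ.reflection_reflection, fun U p hU hU' x => ?_⟩
  · have h1 : Dᗮ.reflection (b i - b' i) = -(b i - b' i) :=
      Submodule.reflection_mem_subspace_orthogonalComplement_eq_neg
        (D.le_orthogonal_orthogonal (Submodule.subset_span ⟨i, rfl⟩))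
    have h2 : Dᗮ.reflection (b i + b' i) = b i + b' i := by
      refine Submodule.reflection_mem_subspace_eq_self ?_
      rw [Submodule.mem_orthogonal]
      intro u hu
      induction hu using Submodule.span_induction with
      | mem u hu =>
        obtain ⟨k, rfl⟩ := hu
        have h3 : inner ℂ (b' k) (b i) = 0 := by
          rw [← inner_conj_symm, hbb', map_zero]
        simp only [inner_sub_left, inner_add_right, hbb', h3, orthonormal_iff_ite.1 hb,
          orthonormal_iff_ite.1 hb']
        ring
      | zero => exact inner_zero_left _
      | add u v _ _ hu hv => rw [inner_add_left, hu, hv, add_zero]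
      | smul c u _ hu => rw [inner_smul_left, hu, mul_zero]
    have h4 : (2 : ℂ) • Dᗮ.reflection (b i) = (2 : ℂ) • b' i := by
      have h5 : (2 : ℂ) • b i = (b i - b' i) + (b i + b' i) := by
        rw [two_smul]
        abel
      rw [← map_smul, h5, map_add, h1, h2, two_smul]
      abel
    exact smul_right_injective H (two_ne_zero' ℂ) h4
  · have hD : D.map (U.toLinearEquiv : H →ₗ[ℂ] H) = D := by
      rw [Submodule.map_span, ← Set.range_comp]
      congr 1
      have h1 : (U.toLinearEquiv : H →ₗ[ℂ] H) ∘ (fun i => b i - b' i) =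
          (fun i => b i - b' i) ∘ p := by
        funext i
        change U (b i - b' i) = _
        rw [map_sub, hU, hU']
        rfl
      rw [h1, p.surjective.range_comp]
    have hDo : Dᗮ.map (U.toLinearEquiv : H →ₗ[ℂ] H) = Dᗮ := by
      conv_rhs => rw [← hD]
      exact (Submodule.map_orthogonal_equiv D U).symm ▸ rfl
    have h2 := Submodule.reflection_map_apply U Dᗮ (U x)
    rw [U.symm_apply_apply] at h2
    rw [← h2]
    congr 1
    simp only [hDo]

/-- If an isometry `V` almost intertwines the unitary operators `τ` and `L`, then the projection
onto its range almost commutes with `L`. -/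
lemma norm_commutator_le_of_almost_intertwining {M : Type*} [NormedAddCommGroup M]
    [InnerProductSpace ℂ M] [CompleteSpace M] (V : M →ₗᵢ[ℂ] H) (L : H ≃ₗᵢ[ℂ] H) (τ : M ≃ₗᵢ[ℂ] M)
    {ε : ℝ} (hε : 0 ≤ ε) (h : ∀ v, ‖L (V v) - V (τ v)‖ ≤ ε * ‖v‖) :
    ‖(V.toContinuousLinearMap ∘L V.toContinuousLinearMap.adjoint) * (L : H →L[ℂ] H) -
      (L : H →L[ℂ] H) * (V.toContinuousLinearMap ∘L V.toContinuousLinearMap.adjoint)‖ ≤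
      2 * ε := by
  set Vc := V.toContinuousLinearMap with hVc
  have hVn : ‖Vc‖ ≤ 1 := V.norm_toContinuousLinearMap_le
  have hVa : ‖Vc.adjoint‖ ≤ 1 := by rwa [LinearIsometryEquiv.norm_map]
  let D : M →L[ℂ] H := (L : H →L[ℂ] H) ∘L Vc - Vc ∘L (τ : M →L[ℂ] M)
  let D' : M →L[ℂ] H := (L.symm : H →L[ℂ] H) ∘L Vc - Vc ∘L (τ.symm : M →L[ℂ] M)
  have hD : ‖D‖ ≤ ε := ContinuousLinearMap.opNorm_le_bound _ hε h
  have hD' : ‖D'‖ ≤ ε := by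
    refine ContinuousLinearMap.opNorm_le_bound _ hε fun v => ?_
    have h1 := h (τ.symm v)
    rw [τ.apply_symm_apply, τ.symm.norm_map, ← L.symm.norm_map, map_sub, L.symm_apply_apply,
      norm_sub_rev] at h1
    exact h1
  have hDa : D'.adjoint = Vc.adjoint ∘L (L : H →L[ℂ] H) - (τ : M →L[ℂ] M) ∘L Vc.adjoint := by
    rw [map_sub, ContinuousLinearMap.adjoint_comp, ContinuousLinearMap.adjoint_comp,
      LinearIsometryEquiv.adjoint_eq_symm, LinearIsometryEquiv.adjoint_eq_symm]
    rfl
  have hkey : (Vc ∘L Vc.adjoint) * (L : H →L[ℂ] H) - (L : H →L[ℂ] H) * (Vc ∘L Vc.adjoint) =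
      Vc ∘L D'.adjoint - D ∘L Vc.adjoint := by
    rw [hDa]
    ext x
    simp [D]
  rw [hkey]
  have h2 : ‖Vc ∘L D'.adjoint‖ ≤ 1 * ε := by
    refine (ContinuousLinearMap.opNorm_comp_le _ _).trans ?_
    gcongr
    rwa [LinearIsometryEquiv.norm_map]
  have h3 : ‖D ∘L Vc.adjoint‖ ≤ ε * 1 := by
    refine (ContinuousLinearMap.opNorm_comp_le _ _).trans ?_
    gcongr
  exact (norm_sub_le _ _).trans (by linarith)

end Projections

/-! ### Almost orthonormal families -/

section AlmostOrthonormal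

open scoped MatrixOrder ComplexOrder in
/-- A diagonally dominant Hermitian matrix is a Gram matrix. -/
lemma exists_inner_eq_of_diagonally_dominant {I : Type*} [Fintype I] (A : Matrix I I ℂ)
    (hA : A.IsHermitian) {δ η : ℝ} (hdiag : ∀ i, A i i = δ) (hoff : ∀ i j, i ≠ j → ‖A i j‖ ≤ η)
    (hη : 0 ≤ η) (hδ : Fintype.card I * η ≤ δ) :
    ∃ θ : I → EuclideanSpace ℂ I, ∀ i j, inner ℂ (θ i) (θ j) = A i j := by
  classical
  have hpos : A.PosSemidef := by
    refine .of_dotProduct_mulVec_nonneg hA fun x => ?_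
    have him : (star x ⬝ᵥ A *ᵥ x).im = 0 := hA.im_star_dotProduct_mulVec_self x
    rw [Complex.le_def]
    refine ⟨?_, him.symm⟩
    have h1 : star x ⬝ᵥ A *ᵥ x = ∑ i, ∑ j, star (x i) * A i j * x j := by
      simp only [dotProduct, Matrix.mulVec, Pi.star_apply, Finset.mul_sum, mul_assoc]
    have h2 : ∀ i j, (if i = j then δ * ‖x i‖ ^ 2 else 0) - η * ((‖x i‖ ^ 2 + ‖x j‖ ^ 2) / 2) ≤
        (star (x i) * A i j * x j).re := by
      intro i j
      by_cases hij : i = j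
      · subst hij
        have h3 : star (x i) * A i i * x i = ((δ * ‖x i‖ ^ 2 : ℝ) : ℂ) := by
          rw [hdiag, mul_right_comm]
          change (starRingEnd ℂ) (x i) * x i * _ = _
          rw [Complex.conj_mul']
          push_cast
          ring
        rw [h3, Complex.ofReal_re, if_pos rfl]
        nlinarith [sq_nonneg ‖x i‖]
      · rw [if_neg hij]
        have h4 := (abs_le.1 (Complex.abs_re_le_norm (star (x i) * A i j * x j))).1
        rw [norm_mul, norm_mul, norm_star] at h4
        have h5 := hoff i j hij
        have h6 : ‖x i‖ * ‖A i j‖ * ‖x j‖ ≤ η * (‖x i‖ * ‖x j‖) := by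
          have := mul_le_mul_of_nonneg_right h5 (mul_nonneg (norm_nonneg (x i)) (norm_nonneg (x j)))
          linarith
        nlinarith [sq_nonneg (‖x i‖ - ‖x j‖)]
    rw [h1, Complex.re_sum, Complex.zero_re]
    simp_rw [Complex.re_sum]
    refine le_trans ?_ (Finset.sum_le_sum fun i _ => Finset.sum_le_sum fun j _ => h2 i j)
    have h7 : ∑ i, ∑ j, ((if i = j then δ * ‖x i‖ ^ 2 else 0) -
        η * ((‖x i‖ ^ 2 + ‖x j‖ ^ 2) / 2)) = (δ - Fintype.card I * η) * ∑ i, ‖x i‖ ^ 2 := by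
      simp only [Finset.sum_sub_distrib, Finset.sum_ite_eq, Finset.mem_univ, if_true,
        ← Finset.mul_sum, ← Finset.sum_div, Finset.sum_add_distrib, Finset.sum_const,
        Finset.card_univ, nsmul_eq_mul]
      ring
    rw [h7]
    have h8 : 0 ≤ δ - Fintype.card I * η := by linarith
    positivity
  obtain ⟨B, hB⟩ := CStarAlgebra.nonneg_iff_eq_star_mul_self.1 (Matrix.nonneg_iff_posSemidef.2 hpos)
  refine ⟨fun i => WithLp.toLp 2 fun k => B k i, fun i j => ?_⟩
  rw [hB, PiLp.inner_apply, Matrix.mul_apply]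
  refine Finset.sum_congr rfl fun k _ => ?_
  rw [RCLike.inner_apply, mul_comm]
  rfl

/-- The isometry from `ℂ^I` determined by an orthonormal family. -/
lemma exists_linearIsometry_of_orthonormal {I K : Type*} [Fintype I] [NormedAddCommGroup K]
    [InnerProductSpace ℂ K] {w : I → K} (hw : Orthonormal ℂ w) :
    ∃ J : EuclideanSpace ℂ I →ₗᵢ[ℂ] K, ∀ x, J x = ∑ i, x i • w i := by
  classical
  let b := EuclideanSpace.basisFun I ℂ
  let f : EuclideanSpace ℂ I →ₗ[ℂ] K := b.toBasis.constr ℂ w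
  have hf : f ∘ b.toBasis = w := funext fun i => b.toBasis.constr_basis ℂ w i
  refine ⟨f.isometryOfOrthonormal (v := b.toBasis) (by rw [b.coe_toBasis]; exact b.orthonormal)
    (by rwa [hf]), fun x => ?_⟩
  exact b.toBasis.constr_apply_fintype ℂ w x

/-- An almost orthonormal family `ζ` of unit vectors becomes exactly orthonormal after a small
perturbation in a larger space. The perturbation shrinks `ζ` slightly and adds components in new
dimensions whose Gram matrix makes up for the defect. -/
lemma exists_orthonormal_near {I K : Type*} [Finite I] [NormedAddCommGroup K]
    [InnerProductSpace ℂ K] {e : ℕ → K} (he : Orthonormal ℂ e) (r n : ℕ)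
    (ζ : I → EuclideanSpace ℂ (Fin n)) (hζ : ∀ i, ‖ζ i‖ = 1) {δ η : ℝ} (hη : 0 ≤ η)
    (hζη : ∀ i j, i ≠ j → ‖inner ℂ (ζ i) (ζ j)‖ ≤ η) (hδ : Nat.card I * η ≤ δ) (hδ1 : δ ≤ 1) :
    ∃ (J : EuclideanSpace ℂ (Fin n) →ₗᵢ[ℂ] K) (ξ : I → K), Orthonormal ℂ ξ ∧
      (∀ i, ∀ j < r, inner ℂ (ξ i) (e j) = 0) ∧ ∀ i, ‖ξ i - J (ζ i)‖ ^ 2 ≤ 2 * δ := by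
  classical
  have := Fintype.ofFinite I
  rw [Nat.card_eq_fintype_card] at hδ
  have hδ0 : 0 ≤ δ := le_trans (by positivity) hδ
  set c : ℝ := √(1 - δ) with hc
  have hc2 : c ^ 2 = 1 - δ := Real.sq_sqrt (by linarith)
  have hc0 : 0 ≤ c := Real.sqrt_nonneg _
  have hc1 : c ≤ 1 := Real.sqrt_le_one.2 (by linarith)
  have hζ2 : ∀ i, inner ℂ (ζ i) (ζ i) = 1 := fun i => by
    rw [inner_self_eq_norm_sq_to_K, hζ]
    simp
  -- The new components have to have the Gram matrix `1 - c² Gram(ζ)`.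
  obtain ⟨θ, hθ⟩ := exists_inner_eq_of_diagonally_dominant
    (Matrix.of fun i j => (if i = j then 1 else 0) - ((1 - δ : ℝ) : ℂ) * inner ℂ (ζ i) (ζ j))
    (by
      ext i j
      simp [Matrix.conjTranspose_apply, eq_comm])
    (δ := δ) (η := η) (fun i => by
      rw [Matrix.of_apply, if_pos rfl, hζ2]
      push_cast
      ring)
    (fun i j hij => by
      rw [Matrix.of_apply, if_neg hij, zero_sub, norm_neg, norm_mul,
        Complex.norm_of_nonneg (by linarith)]
      have := hζη i j hij
      have := norm_nonneg (inner ℂ (ζ i) (ζ j))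
      nlinarith)
    hη hδ
  -- `J` avoids the first `r` vectors `e j`, and the new components avoid the range of `J` as well.
  let w₁ : Fin n → K := fun k => e (r + k)
  let w₂ : I → K := fun i => e (r + n + Fintype.equivFin I i)
  obtain ⟨J₁, hJ₁⟩ := exists_linearIsometry_of_orthonormal (w := w₁)
    (he.comp (fun k : Fin n => r + k) fun k l h => Fin.ext (by simpa using h))
  obtain ⟨J₂, hJ₂⟩ := exists_linearIsometry_of_orthonormal (w := w₂)
    (he.comp (fun i : I => r + n + Fintype.equivFin I i) fun k l h =>
      (Fintype.equivFin I).injective (Fin.ext (by simpa using h)))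
  have hort : ∀ x y, inner ℂ (J₁ x) (J₂ y) = 0 := by
    intro x y
    simp only [hJ₁, hJ₂, sum_inner, inner_sum, inner_smul_left, inner_smul_right]
    refine Finset.sum_eq_zero fun i _ => mul_eq_zero_of_right _ (Finset.sum_eq_zero fun j _ => ?_)
    rw [he.2 (by omega), mul_zero]
  have hort' : ∀ x y, inner ℂ (J₂ x) (J₁ y) = 0 := fun x y => by
    rw [← inner_conj_symm, hort, map_zero]
  refine ⟨J₁, fun i => (c : ℂ) • J₁ (ζ i) + J₂ (θ i), ?_, fun i j hj => ?_, fun i => ?_⟩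
  · rw [orthonormal_iff_ite]
    intro i j
    simp only [inner_add_left, inner_add_right, inner_smul_left, inner_smul_right, hort, hort',
      LinearIsometry.inner_map_map, hθ, Complex.conj_ofReal, Matrix.of_apply, ← hc2]
    push_cast
    ring
  · have h1 : inner ℂ (J₁ (ζ i)) (e j) = 0 := by
      simp only [hJ₁, sum_inner, inner_smul_left]
      refine Finset.sum_eq_zero fun k _ => ?_
      rw [he.2 (by omega), mul_zero]
    have h2 : inner ℂ (J₂ (θ i)) (e j) = 0 := by
      simp only [hJ₂, sum_inner, inner_smul_left]
      refine Finset.sum_eq_zero fun k _ => ?_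
      rw [he.2 (by omega), mul_zero]
    rw [inner_add_left, inner_smul_left, h1, h2, mul_zero, add_zero]
  · have h1 : ‖θ i‖ ^ 2 = δ := by
      have h2 := hθ i i
      rw [inner_self_eq_norm_sq_to_K, Matrix.of_apply, if_pos rfl, hζ2] at h2
      have h3 : ((‖θ i‖ ^ 2 : ℝ) : ℂ) = ((δ : ℝ) : ℂ) := by
        push_cast
        rw [← sub_sub_cancel (1 : ℂ) δ]
        simpa using h2
      exact_mod_cast h3
    have h4 : (c : ℂ) • J₁ (ζ i) + J₂ (θ i) - J₁ (ζ i) =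
        ((c - 1 : ℝ) : ℂ) • J₁ (ζ i) + J₂ (θ i) := by
      rw [Complex.ofReal_sub, Complex.ofReal_one, sub_smul, one_smul]
      abel
    rw [h4, sq, norm_add_sq_eq_norm_sq_add_norm_sq_of_inner_eq_zero _ _ (by
      rw [inner_smul_left, hort, mul_zero]), norm_smul, J₁.norm_map, J₂.norm_map, hζ, mul_one,
      Complex.norm_real, ← sq, ← sq, h1, Real.norm_eq_abs, sq_abs]
    nlinarith

end AlmostOrthonormal

/-! ### Almost intertwining the regular representation -/

section Amplification

variable {K : Type*} [NormedAddCommGroup K] [InnerProductSpace ℂ K]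
variable {M : Type*} [NormedAddCommGroup M] [InnerProductSpace ℂ M]

lemma lp_two_norm_sq {ι : Type*} {E : ι → Type*} [∀ i, NormedAddCommGroup (E i)] (f : lp E 2) :
    ‖f‖ ^ 2 = ∑' i, ‖f i‖ ^ 2 := by
  have := lp.norm_rpow_eq_tsum (p := 2) (by norm_num) f
  simpa using this

lemma lp_two_summable_norm_sq {ι : Type*} {E : ι → Type*} [∀ i, NormedAddCommGroup (E i)]
    (f : lp E 2) : Summable fun i => ‖f i‖ ^ 2 := by
  have := (lp.memℓp f).summable (p := 2) (by norm_num)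
  simpa using this

/-- The operator `v ↦ ∑ₓ a(x) δₓ ⊗ J (u(x) v)` into `ℓ²(G, K)`, for a finitely supported function
`a` and unitary operators `u(x)`. If `u(x) = τ(x)⁻¹` for a representation `τ` and `a` is almost
invariant, then it almost intertwines `τ` and the regular representation. -/
noncomputable def spread {G : Type*} {a : G → ℝ} (ha : a.support.Finite)
    (u : G → M ≃ₗᵢ[ℂ] M) (J : M →L[ℂ] K) : M →L[ℂ] lp (fun _ : G => K) 2 :=
  open scoped Classical in
  ∑ x ∈ ha.toFinset, lp.singleContinuousLinearMap ℂ (fun _ : G => K) 2 x ∘L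
    ((a x : ℂ) • (J ∘L (u x : M →L[ℂ] M)))

lemma spread_apply {G : Type*} {a : G → ℝ} (ha : a.support.Finite) (u : G → M ≃ₗᵢ[ℂ] M)
    (J : M →L[ℂ] K) (v : M) (x : G) : spread ha u J v x = (a x : ℂ) • J (u x v) := by
  classical
  rw [spread, sum_apply, lp.coeFn_sum, Finset.sum_apply]
  by_cases hx : x ∈ ha.toFinset
  · rw [Finset.sum_eq_single x]
    · simp
    · intro y _ hy
      simp [lp.single_apply, hy.symm]
    · exact fun h => absurd hx h
  · have hx0 : a x = 0 := by simpa using hx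
    rw [hx0, Complex.ofReal_zero, zero_smul]
    refine Finset.sum_eq_zero fun y hy => ?_
    have hyx : x ≠ y := fun h => hx (h ▸ hy)
    simp [lp.single_apply, hyx]

lemma norm_spread_of_norm_eq {G : Type*} {a : G → ℝ} (ha : a.support.Finite)
    (ha1 : ∑' x, a x ^ 2 = 1) (u : G → M ≃ₗᵢ[ℂ] M) (J : M →L[ℂ] K) (v : M)
    (h : ∀ x, a x ≠ 0 → ‖J (u x v)‖ = ‖v‖) :
    ‖spread ha u J v‖ = ‖v‖ := by
  rw [← sq_eq_sq₀ (norm_nonneg _) (norm_nonneg _), lp_two_norm_sq]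
  have h1 : ∀ x, ‖spread ha u J v x‖ ^ 2 = a x ^ 2 * ‖v‖ ^ 2 := by
    intro x
    rw [spread_apply, norm_smul, mul_pow, Complex.norm_real, Real.norm_eq_abs, sq_abs]
    by_cases hx : a x = 0
    · simp [hx]
    · rw [h x hx]
  simp_rw [h1]
  rw [tsum_mul_right, ha1, one_mul]

/-- The error of `spread` as an intertwiner comes from the failure of `a` to be invariant and from
the failure of `u (g⁻¹ * x)` to factor as `u x` times a fixed operator sending `v` to `w`. -/
lemma norm_lpTranslate_spread_sub_le {G : Type*} [Group G] {a : G → ℝ}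
    (ha : a.support.Finite) (ha1 : ∑' x, a x ^ 2 = 1)
    (u : G → M ≃ₗᵢ[ℂ] M) (J : M →L[ℂ] K) (hJ : ‖J‖ ≤ 1) {ε : ℝ} (hε : 0 ≤ ε) (g : G)
    (hg : ∑' x, (a (g⁻¹ * x) - a x) ^ 2 ≤ ε ^ 2) (v w : M)
    (hvw : ∀ x, a x ≠ 0 → ‖u (g⁻¹ * x) v - u x w‖ ≤ ε * ‖v‖) :
    ‖lpTranslate ℂ 2 g (spread ha u J v) - spread ha u J w‖ ≤ 2 * ε * ‖v‖ := by
  rw [← sq_le_sq₀ (norm_nonneg _) (by positivity), lp_two_norm_sq]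
  have hpt : ∀ x, ‖(lpTranslate ℂ 2 g (spread ha u J v) - spread ha u J w) x‖ ^ 2 ≤
      2 * ‖v‖ ^ 2 * (a (g⁻¹ * x) - a x) ^ 2 + 2 * ε ^ 2 * ‖v‖ ^ 2 * a x ^ 2 := by
    intro x
    have h1 : (lpTranslate ℂ 2 g (spread ha u J v) - spread ha u J w) x =
        ((a (g⁻¹ * x) - a x : ℝ) : ℂ) • J (u (g⁻¹ * x) v) +
          (a x : ℂ) • J (u (g⁻¹ * x) v - u x w) := by
      rw [lp.coeFn_sub, Pi.sub_apply, lpTranslate_apply, spread_apply, spread_apply, map_sub,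
        smul_sub, Complex.ofReal_sub, sub_smul]
      abel
    have h2 : ‖(lpTranslate ℂ 2 g (spread ha u J v) - spread ha u J w) x‖ ≤
        |a (g⁻¹ * x) - a x| * ‖v‖ + |a x| * (ε * ‖v‖) := by
      rw [h1]
      refine (norm_add_le _ _).trans (add_le_add ?_ ?_)
      · rw [norm_smul, Complex.norm_real, Real.norm_eq_abs]
        refine mul_le_mul_of_nonneg_left ?_ (abs_nonneg _)
        simpa using J.le_of_opNorm_le hJ (u (g⁻¹ * x) v)
      · rw [norm_smul, Complex.norm_real, Real.norm_eq_abs]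
        by_cases hx : a x = 0
        · simp [hx]
        · refine mul_le_mul_of_nonneg_left ?_ (abs_nonneg _)
          exact (J.le_of_opNorm_le hJ _).trans ((one_mul _).trans_le (hvw x hx))
    refine (pow_le_pow_left₀ (norm_nonneg _) h2 2).trans ?_
    have h3 := sq_abs (a (g⁻¹ * x) - a x)
    have h4 := sq_abs (a x)
    have h5 := sq_nonneg (|a (g⁻¹ * x) - a x| * ‖v‖ - |a x| * (ε * ‖v‖))
    rw [← h3, ← h4]
    nlinarith
  have hs1 : Summable fun x => a x ^ 2 :=
    summable_of_hasFiniteSupport (ha.subset fun x hx => by simpa using hx)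
  have hs2 : Summable fun x => (a (g⁻¹ * x) - a x) ^ 2 := by
    refine summable_of_hasFiniteSupport
      ((ha.union (ha.image (g * ·))).subset fun x hx => ?_)
    by_contra h
    simp only [Set.mem_union, Function.mem_support, not_or, not_not, Set.mem_image, not_exists,
      not_and] at h
    have h6 : a (g⁻¹ * x) = 0 := by
      by_contra h7
      exact h.2 _ h7 (mul_inv_cancel_left g x)
    simp [h.1, h6] at hx
  refine ((lp_two_summable_norm_sq _).tsum_le_tsum hpt
    ((hs2.mul_left _).add (hs1.mul_left _))).trans ?_
  rw [(hs2.mul_left _).tsum_add (hs1.mul_left _), tsum_mul_left, tsum_mul_left, ha1]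
  nlinarith [mul_le_mul_of_nonneg_left hg (sq_nonneg ‖v‖)]

end Amplification

/-! ### Transport to another Hilbert space -/

section Transport

variable {H H' : Type*} [NormedAddCommGroup H] [InnerProductSpace ℂ H] [CompleteSpace H]
  [NormedAddCommGroup H'] [InnerProductSpace ℂ H'] [CompleteSpace H']

lemma LinearIsometryEquiv.norm_conjStarAlgEquiv_le (R : H ≃ₗᵢ[ℂ] H') (T : H →L[ℂ] H) :
    ‖R.conjStarAlgEquiv T‖ ≤ ‖T‖ := by
  refine ContinuousLinearMap.opNorm_le_bound _ (norm_nonneg _) fun x => ?_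
  rw [R.conjStarAlgEquiv_apply_apply, R.norm_map]
  refine (T.le_opNorm _).trans_eq ?_
  rw [R.symm.norm_map]

lemma LinearIsometryEquiv.isStarProjection_conjStarAlgEquiv (R : H ≃ₗᵢ[ℂ] H') {P : H →L[ℂ] H}
    (hP : IsStarProjection P) : IsStarProjection (R.conjStarAlgEquiv P) := by
  refine ⟨?_, ?_⟩
  · change _ * _ = _
    rw [← map_mul, hP.isIdempotentElem]
  · change star _ = _
    exact (R.conjStarAlgEquiv.map_star' P).symm.trans
      (congrArg R.conjStarAlgEquiv hP.isSelfAdjoint)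

lemma IsQuasidiagonalSet.image_conjStarAlgEquiv {Ω : Set (H →L[ℂ] H)} (hΩ : IsQuasidiagonalSet Ω)
    (R : H ≃ₗᵢ[ℂ] H') : IsQuasidiagonalSet (R.conjStarAlgEquiv '' Ω) := by
  obtain ⟨P, hP, hPc, hPm, hPlim, hPcomm⟩ := hΩ
  refine ⟨fun k => R.conjStarAlgEquiv (P k),
    fun k => R.isStarProjection_conjStarAlgEquiv (hP k), fun k => ?_, fun k l hkl => ?_,
    fun x => ?_, ?_⟩
  · exact ((hPc k).comp_clm (R.symm.toContinuousLinearEquiv : H' →L[ℂ] H)).clm_comp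
      (R.toContinuousLinearEquiv : H →L[ℂ] H')
  · rw [← map_mul, hPm k l hkl]
  · have := (R.continuous.tendsto _).comp (hPlim (R.symm x))
    rwa [R.apply_symm_apply] at this
  · rintro _ ⟨T, hT, rfl⟩
    refine squeeze_zero (fun k => norm_nonneg _) (fun k => ?_) (hPcomm T hT)
    rw [← map_mul, ← map_mul, ← map_sub]
    exact R.norm_conjStarAlgEquiv_le _

end Transport

/-! ### Almost invariant projections for the regular representation -/

section LocalQuasidiagonality

/-- The operator of left translation by `g` on `ℓ²(G, K)`: the regular representation of `G` with
multiplicity space `K`. -/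
noncomputable abbrev leftRegular {G : Type*} [Group G] (K : Type*) [NormedAddCommGroup K]
    [InnerProductSpace ℂ K] (g : G) : lp (fun _ : G => K) 2 →L[ℂ] lp (fun _ : G => K) 2 :=
  ((lpTranslate (E := K) ℂ 2 g).toContinuousLinearEquiv :
    lp (fun _ : G => K) 2 →L[ℂ] lp (fun _ : G => K) 2)

lemma LinearIsometry.isStarProjection_comp_adjoint {M H : Type*} [NormedAddCommGroup M]
    [InnerProductSpace ℂ M] [CompleteSpace M] [NormedAddCommGroup H] [InnerProductSpace ℂ H]
    [CompleteSpace H] (V : M →ₗᵢ[ℂ] H) :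
    IsStarProjection (V.toContinuousLinearMap ∘L V.toContinuousLinearMap.adjoint) := by
  have h1 : V.toContinuousLinearMap.adjoint ∘L V.toContinuousLinearMap = 1 :=
    (ContinuousLinearMap.norm_map_iff_adjoint_comp_self _).1 V.norm_map
  refine ⟨?_, ?_⟩
  · change _ ∘L _ = _
    rw [ContinuousLinearMap.comp_assoc,
      ← ContinuousLinearMap.comp_assoc _ _ (ContinuousLinearMap.adjoint _), h1]
    rfl
  · rw [IsSelfAdjoint, ContinuousLinearMap.star_eq_adjoint, ContinuousLinearMap.adjoint_comp,
      ContinuousLinearMap.adjoint_adjoint]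

/-- The projection onto the range of the almost intertwiner `spread` almost commutes with given
translations. For a suitable representation of `Γ` its range almost contains vectors `w j` whose
translates are exactly orthonormal; reflecting them to `δ₁ ⊗ e j`, which does not affect the
commutators, gives a projection that almost fixes the latter vectors. -/
theorem exists_almost_invariant_projection {Γ : Type*} [Group Γ] [Group.ResiduallyFinite Γ]
    (N : Subgroup Γ) [N.Normal] (hN : N ≤ Subgroup.center Γ)
    (hG : HasAlmostInvariantVectors (Γ ⧸ N)) {K : Type*} [NormedAddCommGroup K]
    [InnerProductSpace ℂ K] [CompleteSpace K] {e : ℕ → K} (he : Orthonormal ℂ e)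
    [DecidableEq (Γ ⧸ N)]
    (S : Finset (Γ ⧸ N)) {ε : ℝ} (hε : 0 < ε) (r : ℕ) :
    ∃ P : lp (fun _ : Γ ⧸ N => K) 2 →L[ℂ] lp (fun _ : Γ ⧸ N => K) 2,
      IsStarProjection P ∧ FiniteDimensional ℂ P.range ∧
      (∀ g ∈ S, ‖P * leftRegular K g - leftRegular K g * P‖ ≤ ε) ∧
      ∀ j < r, ‖P (lp.single 2 1 (e j)) - lp.single 2 1 (e j)‖ ≤ ε := by
  classical
  obtain ⟨a, ha, ha1, haS⟩ := hG S ((ε / 4) ^ 2) (by positivity)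
  set s := ha.toFinset with hs
  let φ : Γ ⧸ N → Γ := Quotient.out
  have hφ : ∀ x, ((φ x : Γ) : Γ ⧸ N) = x := QuotientGroup.out_eq'
  -- Orthonormalization with defect `δ` moves unit vectors by at most `√(2δ) ≤ ε / 2`, and it needs
  -- inner products of size at most `δ` divided by the number of vectors.
  set δ : ℝ := min 1 (ε ^ 2 / 8) with hδ
  have hδ0 : 0 < δ := by positivity
  set η : ℝ := δ / (Nat.card (s × Fin r) + 1) with hη
  have hη0 : 0 < η := by positivity
  -- Elements of `N` that have to act almost trivially, and elements outside `N` whose matrix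
  -- coefficients have to be small.
  let E : Finset Γ := (S ×ˢ s).image (fun t => (φ (t.1⁻¹ * t.2))⁻¹ * ((φ t.1)⁻¹ * φ t.2)) ∪
    (s ×ˢ s).image fun t => φ t.1 * (φ t.2)⁻¹
  obtain ⟨m, -, U, v, -, hv, hU1, hU2⟩ := exists_almost_trivial_on_central N hN E
    (ε := min (ε / 4) η) (by positivity) r
  let u : Γ ⧸ N → (EuclideanSpace ℂ (Fin m) ≃ₗᵢ[ℂ] EuclideanSpace ℂ (Fin m)) :=
    fun x => U (φ x)⁻¹
  let ζ : s × Fin r → EuclideanSpace ℂ (Fin m) := fun i => u i.1 (v i.2)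
  have hζ1 : ∀ i, ‖ζ i‖ = 1 := fun i => by
    rw [LinearIsometryEquiv.norm_map]
    exact hv.1 _
  have hζ2 : ∀ i j, i ≠ j → ‖inner ℂ (ζ i) (ζ j)‖ ≤ η := by
    rintro ⟨⟨x, hx⟩, i⟩ ⟨⟨y, hy⟩, j⟩ hne
    have h1 : inner ℂ (ζ (⟨x, hx⟩, i)) (ζ (⟨y, hy⟩, j)) =
        inner ℂ (v i) (U (φ x * (φ y)⁻¹) (v j)) := by
      rw [← LinearIsometryEquiv.inner_map_map (U (φ x))]
      change inner ℂ ((U (φ x) * U (φ x)⁻¹) (v i)) ((U (φ x) * U (φ y)⁻¹) (v j)) = _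
      rw [← map_mul, ← map_mul, mul_inv_cancel, map_one]
      rfl
    rw [h1]
    by_cases hxy : x = y
    · subst hxy
      have hij : i ≠ j := fun h => hne (by rw [h])
      rw [mul_inv_cancel, map_one]
      change ‖inner ℂ (v i) (v j)‖ ≤ η
      rw [hv.2 hij, norm_zero]
      exact hη0.le
    · refine (hU2 _ (Finset.mem_union_right _ (Finset.mem_image.2
        ⟨(x, y), Finset.mk_mem_product hx hy, rfl⟩)) (fun h => hxy ?_) i j).trans (min_le_right _ _)
      rw [← QuotientGroup.eq_one_iff, QuotientGroup.mk_mul, QuotientGroup.mk_inv, hφ, hφ] at h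
      exact mul_inv_eq_one.1 h
  obtain ⟨J, ξ, hξ, hξe, hξζ⟩ := exists_orthonormal_near he r m ζ hζ1 (δ := δ) hη0.le hζ2
    (by
      rw [hη, mul_div_assoc', div_le_iff₀ (by positivity)]
      nlinarith)
    (min_le_left _ _)
  let V : EuclideanSpace ℂ (Fin m) →ₗᵢ[ℂ] lp (fun _ : Γ ⧸ N => K) 2 :=
    { toLinearMap := (spread ha u J.toContinuousLinearMap).toLinearMap
      norm_map' := fun v => norm_spread_of_norm_eq ha ha1 u _ v fun x _ => by
        rw [LinearIsometry.coe_toContinuousLinearMap, J.norm_map, LinearIsometryEquiv.norm_map] }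
  have hV : ∀ v x, V v x = (a x : ℂ) • J (u x v) := spread_apply ha u J.toContinuousLinearMap
  let P₀ : lp (fun _ : Γ ⧸ N => K) 2 →L[ℂ] lp (fun _ : Γ ⧸ N => K) 2 :=
    V.toContinuousLinearMap ∘L V.toContinuousLinearMap.adjoint
  have hP₀ : IsStarProjection P₀ := V.isStarProjection_comp_adjoint
  have hP₀V : ∀ v, P₀ (V v) = V v := by
    intro v
    have h1 : V.toContinuousLinearMap.adjoint ∘L V.toContinuousLinearMap = 1 :=
      (ContinuousLinearMap.norm_map_iff_adjoint_comp_self _).1 V.norm_map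
    exact congrArg V (congrArg (fun T => T v) h1)
  have hcomm : ∀ g ∈ S, ‖P₀ * leftRegular K g -
      leftRegular K g * P₀‖ ≤ ε := by
    intro g hg
    refine (norm_commutator_le_of_almost_intertwining V (lpTranslate ℂ 2 g) (U (φ g))
      (ε := 2 * (ε / 4)) (by positivity) fun v => ?_).trans_eq (by ring)
    refine norm_lpTranslate_spread_sub_le ha ha1 u J.toContinuousLinearMap
      J.norm_toContinuousLinearMap_le (by positivity) g (haS g hg) v _ fun x hx => ?_
    have hxs : x ∈ s := by simpa [hs] using hx
    have hmem : (φ (g⁻¹ * x))⁻¹ * ((φ g)⁻¹ * φ x) ∈ N := by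
      rw [← QuotientGroup.eq_one_iff]
      simp only [QuotientGroup.mk_mul, QuotientGroup.mk_inv, hφ]
      group
    have h1 := hU1 _ (Finset.mem_union_left _ (Finset.mem_image.2
      ⟨(g, x), Finset.mk_mem_product hg hxs, rfl⟩)) hmem (U ((φ x)⁻¹ * φ g) v)
    rw [LinearIsometryEquiv.norm_map] at h1
    have h2 : U ((φ (g⁻¹ * x))⁻¹ * ((φ g)⁻¹ * φ x)) (U ((φ x)⁻¹ * φ g) v) = u (g⁻¹ * x) v := by
      change (U _ * U _) v = _
      rw [← map_mul]
      simp [u, mul_assoc]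
    have h3 : U ((φ x)⁻¹ * φ g) v = u x (U (φ g) v) := by
      rw [map_mul]
      rfl
    rw [h2, h3] at h1
    exact h1.trans (mul_le_mul_of_nonneg_right (min_le_left _ _) (norm_nonneg _))
  -- The vectors `w j` have orthonormal translates because all their values are orthogonal, and
  -- these are orthogonal to all `δ_g ⊗ e j` because the values are orthogonal to the `e j`.
  let ξ' : Γ ⧸ N → Fin r → K := fun x j => if h : x ∈ s then ξ (⟨x, h⟩, j) else 0
  let w : Fin r → lp (fun _ : Γ ⧸ N => K) 2 := fun j => ∑ x ∈ s, lp.single 2 x ((a x : ℂ) • ξ' x j)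
  have hw : ∀ j x, w j x = (a x : ℂ) • ξ' x j := by
    intro j x
    simp only [w, lp.coeFn_sum, Finset.sum_apply]
    by_cases hx : x ∈ s
    · rw [Finset.sum_eq_single x (fun y _ hy => by simp [lp.single_apply, hy.symm])
        (fun h => absurd hx h), lp.single_apply_self]
    · have hx0 : ξ' x j = 0 := dif_neg hx
      rw [hx0, smul_zero]
      refine Finset.sum_eq_zero fun y hy => ?_
      have hyx : x ≠ y := fun h => hx (h ▸ hy)
      simp [lp.single_apply, hyx]
  have hwinner : ∀ i j x y, (x, i) ≠ (y, j) → inner ℂ (w i x) (w j y) = 0 := by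
    intro i j x y hne
    rw [hw, hw, inner_smul_left, inner_smul_right]
    by_cases hx : x ∈ s
    · by_cases hy : y ∈ s
      · have h1 : inner ℂ (ξ' x i) (ξ' y j) = 0 := by
          simp only [ξ', dif_pos hx, dif_pos hy]
          refine hξ.2 fun h => hne ?_
          simpa using h
        rw [h1, mul_zero, mul_zero]
      · simp [ξ', hy]
    · simp [ξ', hx]
  have hwe : ∀ i x, ∀ j < r, inner ℂ (w i x) (e j) = 0 := by
    intro i x j hj
    rw [hw, inner_smul_left]
    by_cases hx : x ∈ s
    · simp only [ξ', dif_pos hx]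
      rw [hξe _ j hj, mul_zero]
    · simp [ξ', hx]
  have hw1 : ∀ j, ‖w j‖ = 1 := by
    intro j
    rw [← sq_eq_sq₀ (norm_nonneg _) zero_le_one, lp_two_norm_sq, one_pow, ← ha1]
    refine tsum_congr fun x => ?_
    rw [hw, norm_smul, Complex.norm_real, Real.norm_eq_abs, mul_pow, sq_abs]
    by_cases hx : x ∈ s
    · simp only [ξ', dif_pos hx]
      rw [hξ.1, one_pow, mul_one]
    · have : a x = 0 := by simpa [hs] using hx
      simp [this]
  have hwV : ∀ j, ‖w j - V (v j)‖ ≤ ε / 2 := by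
    intro j
    rw [← sq_le_sq₀ (norm_nonneg _) (by positivity), lp_two_norm_sq]
    have hsum : Summable fun x => a x ^ 2 :=
      summable_of_hasFiniteSupport (ha.subset fun x hx => by simpa using hx)
    have hle : ∀ x, ‖(w j - V (v j)) x‖ ^ 2 ≤ (ε / 2) ^ 2 * a x ^ 2 := by
      intro x
      rw [lp.coeFn_sub, Pi.sub_apply, hw, hV, ← smul_sub, norm_smul, Complex.norm_real,
        Real.norm_eq_abs, mul_pow, sq_abs, mul_comm]
      by_cases hx : x ∈ s
      · refine mul_le_mul_of_nonneg_right ?_ (sq_nonneg _)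
        simp only [ξ', dif_pos hx]
        refine (hξζ (⟨x, hx⟩, j)).trans ?_
        have := min_le_right 1 (ε ^ 2 / 8)
        rw [← hδ] at this
        linarith
      · have : a x = 0 := by simpa [hs] using hx
        simp [this]
    refine ((lp_two_summable_norm_sq _).tsum_le_tsum hle (hsum.mul_left _)).trans_eq ?_
    rw [tsum_mul_left, ha1, mul_one]
  have hP₀w : ∀ j, ‖P₀ (w j) - w j‖ ≤ ε := by
    intro j
    have h1 : P₀ (w j) - w j = P₀ (w j - V (v j)) - (w j - V (v j)) := by
      rw [map_sub, hP₀V]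
      abel
    have h2 := P₀.le_of_opNorm_le (IsStarProjection.norm_le _ hP₀) (w j - V (v j))
    rw [h1]
    refine (norm_sub_le _ _).trans ?_
    linarith [hwV j]
  -- Both families of translates are permuted by translations in the same way, so the operator that
  -- exchanges them commutes with translations.
  let b : (Γ ⧸ N) × Fin r → lp (fun _ : Γ ⧸ N => K) 2 := fun i => lpTranslate ℂ 2 i.1 (w i.2)
  let b' : (Γ ⧸ N) × Fin r → lp (fun _ : Γ ⧸ N => K) 2 :=
    fun i => lpTranslate ℂ 2 i.1 (lp.single 2 1 (e i.2))
  have hb'single : ∀ i, b' i = lp.single 2 i.1 (e i.2) := by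
    rintro ⟨g, j⟩
    ext x
    simp [b', lp.single_apply, Pi.single_apply, inv_mul_eq_one, eq_comm]
  have hb : Orthonormal ℂ b := by
    refine ⟨fun i => ?_, fun i j hij => ?_⟩
    · rw [LinearIsometryEquiv.norm_map, hw1]
    · change inner ℂ (b i) (b j) = 0
      rw [lp.inner_eq_tsum]
      refine (tsum_congr fun x => ?_).trans tsum_zero
      refine hwinner _ _ _ _ fun h => hij ?_
      rw [Prod.mk.injEq, mul_left_inj, inv_inj] at h
      exact Prod.ext h.1 h.2
  have hb' : Orthonormal ℂ b' := by
    refine ⟨fun i => ?_, fun i j hij => ?_⟩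
    · rw [hb'single, lp.norm_single (by norm_num), he.1]
    · change inner ℂ (b' i) (b' j) = 0
      rw [hb'single, hb'single, lp.inner_single_left, lp.single_apply, Pi.single_apply]
      split_ifs with h
      · exact he.2 fun h' => hij (Prod.ext h (Fin.ext h'))
      · exact inner_zero_right _
  have hbb' : ∀ i j, inner ℂ (b i) (b' j) = 0 := by
    intro i j
    rw [hb'single, lp.inner_single_right]
    exact hwe _ _ _ j.2.2
  obtain ⟨R, hR1, hR2, hR3⟩ := exists_swap_orthonormal hb hb' hbb'
  have hRcomm : ∀ g x, R (lpTranslate ℂ 2 g x) = lpTranslate ℂ 2 g (R x) := by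
    intro g x
    refine hR3 (lpTranslate ℂ 2 g) ((Equiv.mulLeft g).prodCongr (Equiv.refl _)) (fun i => ?_)
      (fun i => ?_) x
    · exact (DFunLike.congr_fun (map_mul (lpTranslate ℂ 2) g i.1) (w i.2)).symm
    · exact (DFunLike.congr_fun (map_mul (lpTranslate ℂ 2) g i.1) _).symm
  have hRsymm : ∀ x, R.symm x = R x := fun x => by
    rw [LinearIsometryEquiv.symm_apply_eq, hR2]
  refine ⟨R.conjStarAlgEquiv P₀, ?_, ?_, fun g hg => ?_, fun j hj => ?_⟩
  · exact R.isStarProjection_conjStarAlgEquiv hP₀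
  · refine Submodule.finiteDimensional_of_le (S₂ := V.toLinearMap.range.map
      (R.toLinearEquiv : lp (fun _ : Γ ⧸ N => K) 2 →ₗ[ℂ] lp (fun _ : Γ ⧸ N => K) 2)) ?_
    rintro _ ⟨x, rfl⟩
    exact ⟨_, ⟨V.toContinuousLinearMap.adjoint (R.symm x), rfl⟩, rfl⟩
  · refine ContinuousLinearMap.opNorm_le_bound _ hε.le fun x => ?_
    have h1 : (R.conjStarAlgEquiv P₀ * leftRegular K g -
        leftRegular K g * R.conjStarAlgEquiv P₀) x =
        R ((P₀ * leftRegular K g - leftRegular K g * P₀) (R x)) := by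
      change R (P₀ (R.symm (lpTranslate ℂ 2 g x))) - lpTranslate ℂ 2 g (R (P₀ (R.symm x))) =
        R (P₀ (lpTranslate ℂ 2 g (R x)) - lpTranslate ℂ 2 g (P₀ (R x)))
      rw [hRsymm, hRsymm, hRcomm, map_sub, hRcomm]
    rw [h1, R.norm_map]
    refine (ContinuousLinearMap.le_of_opNorm_le _ (hcomm g hg) _).trans_eq ?_
    rw [R.norm_map]
  · have h1 : R (w ⟨j, hj⟩) = lp.single 2 1 (e j) := by
      have h2 := hR1 (1, ⟨j, hj⟩)
      simp only [b, b', map_one] at h2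
      exact h2
    rw [← h1]
    change ‖R (P₀ (R.symm (R _))) - _‖ ≤ ε
    rw [R.symm_apply_apply, ← map_sub, R.norm_map]
    exact hP₀w _

end LocalQuasidiagonality

/-! ### Faithfulness of the regular representation -/

section Faithfulness

/-- An infinite-dimensional multiplicity space receives every finite-dimensional part of a Hilbert
space isometrically. -/
lemma exists_contraction_isometric_on {M K : Type*} [NormedAddCommGroup M]
    [InnerProductSpace ℂ M] [NormedAddCommGroup K] [InnerProductSpace ℂ K] {e : ℕ → K}
    (he : Orthonormal ℂ e) (W : Submodule ℂ M) [FiniteDimensional ℂ W] :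
    ∃ J : M →L[ℂ] K, ‖J‖ ≤ 1 ∧ ∀ x ∈ W, ‖J x‖ = ‖x‖ := by
  let b := stdOrthonormalBasis ℂ W
  obtain ⟨J₀, -⟩ := exists_linearIsometry_of_orthonormal
    (he.comp (fun i : Fin (Module.finrank ℂ W) => (i : ℕ)) Fin.val_injective)
  refine ⟨J₀.toContinuousLinearMap ∘L (b.repr.toContinuousLinearEquiv : W →L[ℂ] _) ∘L
    W.orthogonalProjectionOnto, ?_, fun x hx => ?_⟩
  · refine ContinuousLinearMap.opNorm_le_bound _ zero_le_one fun x => ?_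
    change ‖J₀ (b.repr (W.orthogonalProjectionOnto x))‖ ≤ _
    rw [J₀.norm_map, b.repr.norm_map]
    exact W.orthogonalProjectionOnto.le_of_opNorm_le W.orthogonalProjectionOnto_norm_le x
  · change ‖J₀ (b.repr (W.orthogonalProjectionOnto x))‖ = _
    rw [J₀.norm_map, b.repr.norm_map]
    exact congrArg norm (W.starProjection_eq_self_iff.2 hx)

/-- For a group with almost invariant vectors, every unitary representation is weakly contained in
the regular one: the norm of an element of the group algebra is attained there. An almost
invariant vector gives an almost isometric almost intertwiner from `π` to `λ ⊗ π`, and `λ ⊗ π` is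
a multiple of `λ`. -/
theorem HasAlmostInvariantVectors.norm_sum_smul_le {G : Type*} [Group G]
    (hG : HasAlmostInvariantVectors G) {K : Type*} [NormedAddCommGroup K]
    [InnerProductSpace ℂ K] {e : ℕ → K} (he : Orthonormal ℂ e) {M : Type*}
    [NormedAddCommGroup M] [InnerProductSpace ℂ M] (π : G →* (M ≃ₗᵢ[ℂ] M)) (S : Finset G)
    (c : G → ℂ) (v : M) :
    ‖∑ g ∈ S, c g • π g v‖ ≤ ‖∑ g ∈ S, c g • leftRegular K g‖ * ‖v‖ := by
  classical
  have key : ∀ ε > 0, ‖∑ g ∈ S, c g • π g v‖ ≤ ‖∑ g ∈ S, c g • leftRegular K g‖ * ‖v‖ +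
      (∑ g ∈ S, ‖c g‖ * (2 * ‖v‖)) * ε := by
    intro ε hε
    obtain ⟨a, ha, ha1, haS⟩ := hG S (ε ^ 2) (by positivity)
    set f := ∑ g ∈ S, c g • π g v with hf
    -- Only finitely many vectors matter, those that `spread` has to map isometrically.
    let u : G → (M ≃ₗᵢ[ℂ] M) := fun x => π x⁻¹
    let W : Submodule ℂ M := Submodule.span ℂ
      ((ha.toFinset.image (u · v) ∪ ha.toFinset.image (u · f) : Finset M) : Set M)
    obtain ⟨J, hJ, hJW⟩ := exists_contraction_isometric_on he W
    have hv : ‖spread ha u J v‖ = ‖v‖ := norm_spread_of_norm_eq ha ha1 u J v fun x hx => by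
      rw [hJW _ (Submodule.subset_span (Finset.mem_coe.2 (Finset.mem_union_left _
        (Finset.mem_image_of_mem _ (by simpa using hx))))), LinearIsometryEquiv.norm_map]
    have hf' : ‖spread ha u J f‖ = ‖f‖ := norm_spread_of_norm_eq ha ha1 u J f fun x hx => by
      rw [hJW _ (Submodule.subset_span (Finset.mem_coe.2 (Finset.mem_union_right _
        (Finset.mem_image_of_mem _ (by simpa using hx))))), LinearIsometryEquiv.norm_map]
    have hg : ∀ g ∈ S, ‖leftRegular K g (spread ha u J v) - spread ha u J (π g v)‖ ≤
        2 * ε * ‖v‖ := by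
      intro g hg
      refine norm_lpTranslate_spread_sub_le ha ha1 u J hJ hε.le g (haS g hg) v _ fun x _ => ?_
      have h1 : u (g⁻¹ * x) v = u x (π g v) := by
        change π (g⁻¹ * x)⁻¹ v = (π x⁻¹ * π g) v
        rw [← map_mul, mul_inv_rev, inv_inv]
      rw [h1, sub_self, norm_zero]
      positivity
    have h2 : spread ha u J f = (∑ g ∈ S, c g • leftRegular K g) (spread ha u J v) -
        ∑ g ∈ S, c g • (leftRegular K g (spread ha u J v) - spread ha u J (π g v)) := by
      rw [sum_apply, ← Finset.sum_sub_distrib, hf, map_sum]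
      refine Finset.sum_congr rfl fun g _ => ?_
      rw [map_smul, smul_sub, smul_apply]
      abel
    rw [← hf', h2]
    refine (norm_sub_le _ _).trans (add_le_add ?_ ?_)
    · rw [← hv]
      exact ContinuousLinearMap.le_opNorm _ _
    · rw [Finset.sum_mul]
      refine (norm_sum_le _ _).trans (Finset.sum_le_sum fun g hgS => ?_)
      rw [norm_smul]
      refine (mul_le_mul_of_nonneg_left (hg g hgS) (norm_nonneg _)).trans_eq (by ring)
  have hlim : Tendsto (fun ε : ℝ => ‖∑ g ∈ S, c g • leftRegular K g‖ * ‖v‖ +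
      (∑ g ∈ S, ‖c g‖ * (2 * ‖v‖)) * ε) (𝓝[>] 0) (𝓝 (‖∑ g ∈ S, c g • leftRegular K g‖ * ‖v‖)) := by
    refine tendsto_nhdsWithin_of_tendsto_nhds ?_
    have : Continuous fun ε : ℝ => ‖∑ g ∈ S, c g • leftRegular K g‖ * ‖v‖ +
      (∑ g ∈ S, ‖c g‖ * (2 * ‖v‖)) * ε := by fun_prop
    simpa using this.tendsto 0
  exact ge_of_tendsto hlim (eventually_nhdsWithin_of_forall fun ε hε => key ε hε)

end Faithfulness

/-! ### Quasidiagonality of the regular representation -/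

section RegularQuasidiagonal

lemma tendsto_norm_zero_of_mem_closure_span {E F : Type*} [NormedAddCommGroup E]
    [NormedSpace ℂ E] [NormedAddCommGroup F] [NormedSpace ℂ F] (T : ℕ → E →ₗ[ℂ] F) {C : ℝ}
    (hC : 0 < C) (hT : ∀ k x, ‖T k x‖ ≤ C * ‖x‖) {s : Set E}
    (hs : ∀ x ∈ s, Tendsto (fun k => ‖T k x‖) atTop (𝓝 0)) {x : E}
    (hx : x ∈ closure (Submodule.span ℂ s : Set E)) :
    Tendsto (fun k => ‖T k x‖) atTop (𝓝 0) := by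
  have hspan : ∀ y ∈ Submodule.span ℂ s, Tendsto (fun k => T k y) atTop (𝓝 0) := by
    intro y hy
    induction hy using Submodule.span_induction with
    | mem y hy => exact tendsto_zero_iff_norm_tendsto_zero.2 (hs y hy)
    | zero => simp
    | add y z _ _ hy hz => simpa using hy.add hz
    | smul c y _ hy => simpa using hy.const_smul c
  rw [Metric.tendsto_atTop]
  intro ε hε
  obtain ⟨y, hy, hxy⟩ := Metric.mem_closure_iff.1 hx (ε / (2 * C)) (by positivity)
  obtain ⟨k₀, hk₀⟩ := Metric.tendsto_atTop.1 (hspan y hy) (ε / 2) (by positivity)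
  refine ⟨k₀, fun k hk => ?_⟩
  have h1 := hk₀ k hk
  rw [dist_zero_right] at h1
  rw [dist_zero_right, norm_norm]
  have h2 : T k x = T k (x - y) + T k y := by rw [map_sub, sub_add_cancel]
  have h3 : C * ‖x - y‖ < ε / 2 := by
    rw [dist_eq_norm, lt_div_iff₀ (by positivity)] at hxy
    linarith
  rw [h2]
  linarith [norm_add_le (T k (x - y)) (T k y), hT k (x - y)]

lemma closure_span_single_eq_univ {ι κ K : Type*} [DecidableEq ι] [NormedAddCommGroup K]
    [InnerProductSpace ℂ K] [CompleteSpace K] (b : HilbertBasis κ ℂ K) :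
    closure (Submodule.span ℂ (Set.range fun p : ι × κ =>
      (lp.single 2 p.1 (b p.2) : lp (fun _ : ι => K) 2)) : Set (lp (fun _ : ι => K) 2)) =
      Set.univ := by
  set W := (Submodule.span ℂ (Set.range fun p : ι × κ =>
    (lp.single 2 p.1 (b p.2) : lp (fun _ : ι => K) 2))).topologicalClosure with hW
  have hWc : IsClosed (W : Set (lp (fun _ : ι => K) 2)) := Submodule.isClosed_topologicalClosure _
  have hsingle : ∀ i (v : K), lp.single 2 i v ∈ W := by
    intro i v
    let W' : Submodule ℂ K :=
      W.comap (lp.singleContinuousLinearMap ℂ (fun _ : ι => K) 2 i).toLinearMap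
    have hW'c : IsClosed (W' : Set K) :=
      hWc.preimage (lp.singleContinuousLinearMap ℂ (fun _ : ι => K) 2 i).continuous
    have hle : (Submodule.span ℂ (Set.range b)).topologicalClosure ≤ W' := by
      refine Submodule.topologicalClosure_minimal _ (Submodule.span_le.2 ?_) hW'c
      rintro _ ⟨j, rfl⟩
      exact Submodule.le_topologicalClosure _ (Submodule.subset_span ⟨(i, j), rfl⟩)
    rw [b.dense_span] at hle
    exact hle (Submodule.mem_top (x := v))
  refine Set.eq_univ_of_forall fun f => ?_
  refine hWc.mem_of_tendsto (lp.hasSum_single (by norm_num) f)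
    (Eventually.of_forall fun s => W.sum_mem fun i _ => hsingle i _)

/-- The projections of `exists_almost_invariant_projection` almost fix vectors `δ₁ ⊗ e j`. As they
almost commute with translations, they almost fix all `δ_g ⊗ e j`, so they tend strongly to `1`. -/
theorem exists_tendsto_projections {Γ : Type*} [Group Γ] [Countable Γ] [Group.ResiduallyFinite Γ]
    (N : Subgroup Γ) [N.Normal] (hN : N ≤ Subgroup.center Γ)
    (hG : HasAlmostInvariantVectors (Γ ⧸ N)) {K : Type*} [NormedAddCommGroup K]
    [InnerProductSpace ℂ K] [CompleteSpace K] (b : HilbertBasis ℕ ℂ K) :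
    ∃ Q : ℕ → lp (fun _ : Γ ⧸ N => K) 2 →L[ℂ] lp (fun _ : Γ ⧸ N => K) 2,
      (∀ k, IsStarProjection (Q k)) ∧ (∀ k, FiniteDimensional ℂ (Q k).range) ∧
      (∀ x, Tendsto (fun k => Q k x) atTop (𝓝 x)) ∧
      ∀ g, Tendsto (fun k => ‖Q k * leftRegular K g - leftRegular K g * Q k‖) atTop (𝓝 0) := by
  classical
  have : Countable (Γ ⧸ N) := (QuotientGroup.mk'_surjective N).countable
  obtain ⟨φ, hφ⟩ := exists_surjective_nat (Γ ⧸ N)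
  have hε : ∀ k : ℕ, (0 : ℝ) < 1 / ((k : ℝ) + 1) := fun k => by positivity
  choose Q hQ hQfin hQcomm hQe using fun k : ℕ => exists_almost_invariant_projection N hN hG
    b.orthonormal ((Finset.range k).image φ) (hε k) k
  have hcomm : ∀ g, Tendsto (fun k => ‖Q k * leftRegular K g - leftRegular K g * Q k‖)
      atTop (𝓝 0) := by
    intro g
    obtain ⟨i, rfl⟩ := hφ g
    refine squeeze_zero' (Eventually.of_forall fun k => norm_nonneg _)
      ((eventually_gt_atTop i).mono fun k hk => hQcomm k _ ?_)
      tendsto_one_div_add_atTop_nhds_zero_nat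
    exact Finset.mem_image_of_mem _ (Finset.mem_range.2 hk)
  refine ⟨Q, hQ, hQfin, fun x => ?_, hcomm⟩
  rw [tendsto_iff_norm_sub_tendsto_zero]
  refine tendsto_norm_zero_of_mem_closure_span
    (fun k => (Q k - 1).toLinearMap) zero_lt_one
    (fun k x => ?_) (s := Set.range fun p : (Γ ⧸ N) × ℕ =>
      (lp.single 2 p.1 (b p.2) : lp (fun _ : Γ ⧸ N => K) 2)) ?_
    (by rw [closure_span_single_eq_univ b]; exact Set.mem_univ x)
  · change ‖(Q k - 1) x‖ ≤ _
    rw [← neg_sub, neg_apply, norm_neg]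
    exact ContinuousLinearMap.le_of_opNorm_le _ (IsStarProjection.norm_le _ (hQ k).one_sub) x
  · rintro _ ⟨⟨g, j⟩, rfl⟩
    have hg : (lp.single 2 g (b j) : lp (fun _ : Γ ⧸ N => K) 2) =
        leftRegular K g (lp.single 2 1 (b j)) := by
      ext x
      change _ = (lp.single 2 1 (b j) : lp (fun _ : Γ ⧸ N => K) 2) (g⁻¹ * x)
      simp [lp.single_apply, Pi.single_apply, inv_mul_eq_one, eq_comm]
    set y : lp (fun _ : Γ ⧸ N => K) 2 := lp.single 2 1 (b j)
    have hlim := (hcomm g).mul_const ‖y‖ |>.add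
      (tendsto_one_div_add_atTop_nhds_zero_nat (𝕜 := ℝ))
    rw [zero_mul, zero_add] at hlim
    refine squeeze_zero' (Eventually.of_forall fun k => norm_nonneg _)
      ((eventually_gt_atTop j).mono fun k hk => ?_) hlim
    have h1 : (Q k - 1) (leftRegular K g y) =
        (Q k * leftRegular K g - leftRegular K g * Q k) y + leftRegular K g (Q k y - y) := by
      rw [map_sub]
      change Q k (leftRegular K g y) - leftRegular K g y =
        Q k (leftRegular K g y) - leftRegular K g (Q k y) + _
      abel
    change ‖(Q k - 1) (lp.single 2 g (b j))‖ ≤ _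
    rw [hg, h1]
    refine (norm_add_le _ _).trans (add_le_add (ContinuousLinearMap.le_opNorm _ _) ?_)
    refine ((lpTranslate ℂ 2 g).norm_map _).trans_le ?_
    exact hQe k j hk

end RegularQuasidiagonal

/-! ### The full group C*-algebra -/

section GroupCStar

universe v

variable {G : Type v} [Group G]

lemma universalRep_apply (g : G) (π : UnitaryRep G) :
    universalRep G g π = (π.rep g : π.space →L[ℂ] π.space) := rfl

/-- The universal unitaries form a group, so their span is already a *-algebra. -/
lemma coe_adjoin_universalRep :
    (StarAlgebra.adjoin ℂ (Set.range (universalRep G)) : Set (UnitaryRepProd G)) =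
      Submodule.span ℂ (Set.range (universalRep G)) := by
  let f : G →* UnitaryRepProd G :=
    { toFun := universalRep G
      map_one' := by
        ext1
        funext π
        rw [universalRep_apply, map_one, lp.infty_coeFn_one]
        rfl
      map_mul' := fun g h => by
        ext1
        funext π
        rw [universalRep_apply, map_mul, lp.infty_coeFn_mul]
        rfl }
  have hstar : ∀ g, star (f g) = f g⁻¹ := by
    intro g
    ext1
    funext π
    change star (π.rep g : π.space →L[ℂ] π.space) = (π.rep g⁻¹ : π.space →L[ℂ] π.space)
    rw [map_inv]
    rfl
  have h1 : Submonoid.closure (Set.range f ∪ star (Set.range f)) = MonoidHom.mrange f := by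
    refine le_antisymm ((Submonoid.closure_le).2 ?_) ?_
    · rintro x (hx | ⟨g, hg⟩)
      · exact hx
      · refine ⟨g⁻¹, ?_⟩
        rw [← hstar, hg, star_star]
    · rintro _ ⟨g, rfl⟩
      exact Submonoid.subset_closure (Or.inl ⟨g, rfl⟩)
  have h2 := StarAlgebra.adjoin_eq_span (R := ℂ) (Set.range f)
  rw [h1] at h2
  exact congrArg (fun W : Submodule ℂ (UnitaryRepProd G) => (W : Set (UnitaryRepProd G))) h2

lemma coe_groupCStarSubalgebra :
    (groupCStarSubalgebra G : Set (UnitaryRepProd G)) =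
      closure (Submodule.span ℂ (Set.range (universalRep G)) : Set (UnitaryRepProd G)) := by
  rw [groupCStarSubalgebra, StarSubalgebra.topologicalClosure_coe, coe_adjoin_universalRep]

lemma separableSpace_groupCStarAlgebra [Countable G] :
    TopologicalSpace.SeparableSpace (GroupCStarAlgebra G) := by
  have h : TopologicalSpace.IsSeparable (groupCStarSubalgebra G : Set (UnitaryRepProd G)) := by
    rw [coe_groupCStarSubalgebra]
    exact ((Set.countable_range (universalRep G)).isSeparable.span (R := ℂ)).closure
  exact h.separableSpace

/-- The representation of `C*(G)` integrating a unitary representation of `G`. -/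
noncomputable def UnitaryRep.toStarAlgHom (π : UnitaryRep G) :
    GroupCStarAlgebra G →⋆ₐ[ℂ] (π.space →L[ℂ] π.space) where
  toFun T := (T : UnitaryRepProd G) π
  map_one' := rfl
  map_mul' _ _ := rfl
  map_zero' := rfl
  map_add' _ _ := rfl
  commutes' _ := rfl
  map_star' _ := rfl

/-- The left regular representation on `ℓ²(G, K)`, with multiplicity space `K`. -/
noncomputable def leftRegularRep (G : Type v) [Group G] (K : Type) [NormedAddCommGroup K]
    [InnerProductSpace ℂ K] [CompleteSpace K] [Nontrivial K] : UnitaryRep G :=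
  { space := lp (fun _ : G => K) 2
    nontriv := by
      classical
      obtain ⟨v, hv⟩ := exists_ne (0 : K)
      refine ⟨lp.single 2 1 v, 0, fun h => hv ?_⟩
      rw [← norm_eq_zero, ← lp.norm_single (E := fun _ : G => K) (p := 2) (by norm_num) 1 v, h,
        norm_zero]
    rep := (Unitary.linearIsometryEquiv.symm.toMonoidHom).comp (lpTranslate ℂ 2) }

/-- The norm of the full group C*-algebra is attained in the regular representation. -/
lemma norm_apply_le_of_hasAlmostInvariantVectors (hG : HasAlmostInvariantVectors G) {K : Type}
    [NormedAddCommGroup K] [InnerProductSpace ℂ K] [CompleteSpace K] [Nontrivial K] {e : ℕ → K}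
    (he : Orthonormal ℂ e) (π : UnitaryRep G) {T : UnitaryRepProd G}
    (hT : T ∈ groupCStarSubalgebra G) : ‖T π‖ ≤ ‖T (leftRegularRep G K)‖ := by
  rw [← SetLike.mem_coe, coe_groupCStarSubalgebra] at hT
  have hclosed : IsClosed {T : UnitaryRepProd G | ‖T π‖ ≤ ‖T (leftRegularRep G K)‖} :=
    isClosed_le (lp.evalCLM ℂ (fun π : UnitaryRep G => π.space →L[ℂ] π.space) ∞ π).continuous.norm
      (lp.evalCLM ℂ (fun π : UnitaryRep G => π.space →L[ℂ] π.space) ∞ _).continuous.norm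
  refine closure_minimal ?_ hclosed hT
  intro T hT
  obtain ⟨c, rfl⟩ := (Finsupp.mem_span_range_iff_exists_finsupp).1 hT
  have happ : ∀ ρ : UnitaryRep G, (c.sum fun g z => z • universalRep G g) ρ =
      ∑ g ∈ c.support, c g • (ρ.rep g : ρ.space →L[ℂ] ρ.space) := by
    intro ρ
    rw [Finsupp.sum, lp.coeFn_sum, Finset.sum_apply]
    rfl
  change ‖(c.sum fun g z => z • universalRep G g) π‖ ≤
    ‖(c.sum fun g z => z • universalRep G g) (leftRegularRep G K)‖
  rw [happ, happ]
  refine ContinuousLinearMap.opNorm_le_bound _ (norm_nonneg _) fun v => ?_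
  rw [sum_apply]
  exact hG.norm_sum_smul_le he (Unitary.linearIsometryEquiv.toMonoidHom.comp π.rep) c.support c v

lemma injective_toStarAlgHom_leftRegularRep (hG : HasAlmostInvariantVectors G) {K : Type}
    [NormedAddCommGroup K] [InnerProductSpace ℂ K] [CompleteSpace K] [Nontrivial K] {e : ℕ → K}
    (he : Orthonormal ℂ e) : Function.Injective (leftRegularRep G K).toStarAlgHom := by
  rw [injective_iff_map_eq_zero]
  intro T hT
  ext1
  ext1
  funext π
  have h1 := norm_apply_le_of_hasAlmostInvariantVectors hG he π T.2
  have h2 : (T : UnitaryRepProd G) (leftRegularRep G K) = 0 := hT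
  rw [h2, norm_zero] at h1
  exact norm_le_zero_iff.1 h1

end GroupCStar

/-! ### Quasidiagonality of the group C*-algebra -/

section GroupCStarQuasidiagonal

universe v

/-- The definition of quasidiagonality asks for a Hilbert space in the lowest universe; any Hilbert
space that is isometric to such a space will do. -/
lemma isQuasidiagonal_of_linearIsometryEquiv {A : Type*} [CStarAlgebra A]
    [TopologicalSpace.SeparableSpace A] {H : Type*} [NormedAddCommGroup H]
    [InnerProductSpace ℂ H] [CompleteSpace H] {H' : Type} [NormedAddCommGroup H']
    [InnerProductSpace ℂ H'] [CompleteSpace H'] [TopologicalSpace.SeparableSpace H']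
    (R : H ≃ₗᵢ[ℂ] H') (ρ : A →⋆ₐ[ℂ] (H →L[ℂ] H)) (hρ : Function.Injective ρ)
    (h : IsQuasidiagonalSet (Set.range ρ)) : IsQuasidiagonal A := by
  refine ⟨inferInstance, H', inferInstance, inferInstance, inferInstance, inferInstance,
    { toAlgHom := R.conjStarAlgEquiv.toAlgEquiv.toAlgHom.comp ρ.toAlgHom
      map_star' := fun T => (congrArg R.conjStarAlgEquiv (ρ.map_star' T)).trans
        (R.conjStarAlgEquiv.map_star' _) }, R.conjStarAlgEquiv.injective.comp hρ, ?_⟩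
  have h' := h.image_conjStarAlgEquiv R
  rwa [← Set.range_comp] at h'

theorem isQuasidiagonalSet_range_leftRegularRep {Γ : Type v} [Group Γ] [Countable Γ]
    [Group.ResiduallyFinite Γ] (N : Subgroup Γ) [N.Normal] (hN : N ≤ Subgroup.center Γ)
    (hG : HasAlmostInvariantVectors (Γ ⧸ N)) {K : Type} [NormedAddCommGroup K]
    [InnerProductSpace ℂ K] [CompleteSpace K] [Nontrivial K] (b : HilbertBasis ℕ ℂ K) :
    IsQuasidiagonalSet (Set.range (leftRegularRep (Γ ⧸ N) K).toStarAlgHom) := by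
  obtain ⟨Q, hQ, hQfin, hQlim, hQcomm⟩ := exists_tendsto_projections N hN hG b
  refine isQuasidiagonalSet_of_tendsto Q hQ hQfin hQlim ?_
  rintro _ ⟨T, rfl⟩
  let ev : UnitaryRepProd (Γ ⧸ N) →L[ℂ]
      (lp (fun _ : Γ ⧸ N => K) 2 →L[ℂ] lp (fun _ : Γ ⧸ N => K) 2) :=
    lp.evalCLM ℂ (fun π : UnitaryRep (Γ ⧸ N) => π.space →L[ℂ] π.space) ∞
      (leftRegularRep (Γ ⧸ N) K)
  have hmem : (T : UnitaryRepProd (Γ ⧸ N)) ∈ closure (Submodule.span ℂ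
      (Set.range (universalRep (Γ ⧸ N))) : Set (UnitaryRepProd (Γ ⧸ N))) := by
    rw [← coe_groupCStarSubalgebra]
    exact T.2
  refine tendsto_norm_zero_of_mem_closure_span
    (fun k => (LinearMap.mulLeft ℂ (Q k) - LinearMap.mulRight ℂ (Q k)) ∘ₗ ev.toLinearMap)
    zero_lt_two (fun k x => ?_) ?_ hmem
  · change ‖Q k * ev x - ev x * Q k‖ ≤ _
    have h1 : ‖Q k‖ ≤ 1 := IsStarProjection.norm_le _ (hQ k)
    have h2 : ‖ev x‖ ≤ ‖x‖ := lp.norm_apply_le_norm (by simp) x _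
    have h3 : ‖Q k * ev x‖ ≤ 1 * ‖x‖ := (norm_mul_le _ _).trans (by gcongr)
    have h4 : ‖ev x * Q k‖ ≤ ‖x‖ * 1 := (norm_mul_le _ _).trans (by gcongr)
    refine (norm_sub_le _ _).trans ?_
    linarith
  · rintro _ ⟨g, rfl⟩
    exact hQcomm g

theorem isQuasidiagonal_groupCStarAlgebra_quotient {Γ : Type v} [Group Γ] [Countable Γ]
    [Group.ResiduallyFinite Γ] (N : Subgroup Γ) [N.Normal] (hN : N ≤ Subgroup.center Γ)
    (hG : HasAlmostInvariantVectors (Γ ⧸ N)) : IsQuasidiagonal (GroupCStarAlgebra (Γ ⧸ N)) := by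
  classical
  have : Countable (Γ ⧸ N) := (QuotientGroup.mk'_surjective N).countable
  let b : HilbertBasis ℕ ℂ (lp (fun _ : ℕ => ℂ) 2) := .ofRepr (.refl ℂ _)
  have : Nontrivial (lp (fun _ : ℕ => ℂ) 2) := ⟨b 0, 0, b.orthonormal.ne_zero 0⟩
  let K := lp (fun _ : ℕ => ℂ) 2
  let ι := Shrink.{0, v} (Γ ⧸ N)
  have : Countable ι := (equivShrink.{0, v} (Γ ⧸ N)).symm.countable_iff.2 inferInstance
  -- Relabelling the countable group brings `ℓ²(G, K)` to the lowest universe.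
  let R : lp (fun _ : Γ ⧸ N => K) 2 ≃ₗᵢ[ℂ] lp (fun _ : ι => K) 2 :=
    { toFun := fun f => ⟨fun x => f ((equivShrink _).symm x), memℓp_comp_equiv _ f.2⟩
      invFun := fun f => ⟨fun x => f (equivShrink _ x), memℓp_comp_equiv _ f.2⟩
      left_inv := fun f => by ext x; simp
      right_inv := fun f => by ext x; simp
      map_add' := fun f f' => rfl
      map_smul' := fun c f => by ext x; simp
      norm_map' := fun f => lp_norm_comp_equiv (equivShrink _).symm f }
  have hsep : TopologicalSpace.SeparableSpace (lp (fun _ : ι => K) 2) := by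
    rw [← TopologicalSpace.isSeparable_univ_iff, ← closure_span_single_eq_univ b]
    exact ((Set.countable_range _).isSeparable.span (R := ℂ)).closure
  have := separableSpace_groupCStarAlgebra (G := Γ ⧸ N)
  exact isQuasidiagonal_of_linearIsometryEquiv R (leftRegularRep (Γ ⧸ N) K).toStarAlgHom
    (injective_toStarAlgHom_leftRegularRep hG b.orthonormal)
    (isQuasidiagonalSet_range_leftRegularRep N hN hG b)

end GroupCStarQuasidiagonal

theorem mainTheorem4 {Γ : Type*} [Group Γ] [Countable Γ] [Group.ResiduallyFinite Γ]
    (N : Subgroup Γ) [N.Normal] (hN : N ≤ Subgroup.center Γ) :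
    IsMFGroup (Γ ⧸ N) ∧
    (∃ n : ℕ → ℕ+, StrictMono n ∧
      ∃ σ : ∀ k, Γ →* Matrix.unitaryGroup (Fin (n k)) ℂ,
        (∀ k, IsInducedFromCentralOfFiniteQuotient (σ k)) ∧
        ∃ Φ : Γ ⧸ N →* unitary (MatrixCorona n), Function.Injective Φ ∧
          ∀ x : Γ, ∃ a : MatrixProd n,
            (∀ k, a k = (σ k x : Matrix (Fin (n k)) (Fin (n k)) ℂ)) ∧
            (Φ (x : Γ ⧸ N) : MatrixCorona n) = MatrixCorona.mk n a) ∧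
    (IsAmenableGroup Γ → IsQuasidiagonal (GroupCStarAlgebra (Γ ⧸ N))) := by
  have h := exists_embedding_of_central N hN
  refine ⟨?_, h, fun hΓ => ?_⟩
  · obtain ⟨n, hn, -, -, Φ, hΦ, -⟩ := h
    exact ⟨n, hn, Φ, hΦ⟩
  · have hG := hΓ.of_surjective (QuotientGroup.mk' N) (QuotientGroup.mk'_surjective N)
    exact isQuasidiagonal_groupCStarAlgebra_quotient N hN hG.hasAlmostInvariantVectors
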